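/- For every real $\varepsilon>0$ there is a real number $C_0$ (depending only on $\varepsilon$) such that the following holds for every real $C\ge C_0$ and every integer $d\ge C$. Let $P$ be the path with $d$ edges, and let $G$ be a finite simple graph with $e(G)\ge \varepsilon d|G|$ that contains no copy of $P$ as a (not necessarily induced) subgraph, where $|G|$ and $e(G)$ are the numbers of vertices and edges of $G$. Then there is a set $D$ of at most $\varepsilon e(G)$ edges of $G$ such that, for the graph $H$ obtained from $G$ by deleting the edges in $D$, every connected component $K$ of $H$ has a vertex cover of order at most $Cd$, that is, a set $S\subseteq V(K)$ with $|S|\le Cd$ that meets every edge of $K$. -/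

import Mathlib

/-! The edges of G, up to few, are cut into highly connected pieces that hardly overlap. A longest
path covers most edges of its piece and has at most d vertices, so covers of order d suffice once d
is large. Fix scales b ≪ k ≪ d, with k/d of order ε² and b/k of order ε. Mader's theorem
(`exists_sConn_subgraph`) peels off edge-disjoint k-connected subgraphs until at most 2k|G| edges
remain.

The engine is `SConn.exists_longer_path`: in a sufficiently connected graph, a path disjoint from a
highly connected subgraph R can trade a short segment for a long detour through R. It is used twice.
A longest path of a piece must meet all but 2b|H| of the edges of the piece H, as otherwise Mader's
theorem yields such an R off the path. And if two pieces overlap substantially, their union is again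
a piece: either its connectivity does not drop, or it drops by one step of the scale `s` while the
guaranteed path grows by q. Since paths have fewer than d edges, at most T steps occur.

In a family with as few pieces as possible no two pieces can be merged, so overlaps are tiny. Some
piece then shares at most b vertices with all the others together (`exists_few_shared`): otherwise a
path could wander through T pieces, gaining q edges in each. Removing such pieces one at a time, at
most b vertices per piece separate them all. The deleted edges number at most 2k|G| plus 3b|H| for
each piece H; as k|H| ≤ e(H), this is at most εe(G). -/

namespace SimpleGraph

variable {V : Type*}

/-! ### Walks inside a vertex set -/

/-- There is a walk from `u` to `v` in `H` all of whose vertices lie in `S`. -/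
def ConnIn (H : SimpleGraph V) (S : Set V) (u v : V) : Prop :=
  ∃ p : H.Walk u v, ∀ x ∈ p.support, x ∈ S

namespace ConnIn

variable {H H' : SimpleGraph V} {S T : Set V} {u v w : V}

theorem refl (h : u ∈ S) : ConnIn H S u u := ⟨.nil, by simpa using h⟩

theorem symm (h : ConnIn H S u v) : ConnIn H S v u := by
  obtain ⟨p, hp⟩ := h
  exact ⟨p.reverse, by simpa using hp⟩

theorem trans (h : ConnIn H S u v) (h' : ConnIn H S v w) : ConnIn H S u w := by
  obtain ⟨p, hp⟩ := h
  obtain ⟨q, hq⟩ := h'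
  refine ⟨p.append q, fun x hx => ?_⟩
  rcases Walk.mem_support_append_iff p q |>.1 hx with h | h
  exacts [hp _ h, hq _ h]

theorem mono (hH : H ≤ H') (hS : S ⊆ T) (h : ConnIn H S u v) : ConnIn H' T u v := by
  obtain ⟨p, hp⟩ := h
  exact ⟨p.mapLe hH, fun x hx => hS (hp x (by simpa using hx))⟩

theorem of_adj (h : H.Adj u v) (hu : u ∈ S) (hv : v ∈ S) : ConnIn H S u v :=
  ⟨h.toWalk, by simp [hu, hv]⟩

theorem left_mem (h : ConnIn H S u v) : u ∈ S := h.choose_spec _ (Walk.start_mem_support _)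

theorem right_mem (h : ConnIn H S u v) : v ∈ S := h.choose_spec _ (Walk.end_mem_support _)

theorem exists_isPath (h : ConnIn H S u v) :
    ∃ p : H.Walk u v, p.IsPath ∧ ∀ x ∈ p.support, x ∈ S := by
  classical
  obtain ⟨p, hp⟩ := h
  exact ⟨p.bypass, p.bypass_isPath, fun x hx => hp x (p.support_bypass_subset_support hx)⟩

/-- The vertices of a walk are themselves reachable inside the walk. -/
theorem restrict (h : ConnIn H S u v) : ConnIn H (S ∩ {x | ConnIn H S u x}) u v := by
  classical
  obtain ⟨p, hp⟩ := h
  refine ⟨p, fun x hx => ⟨hp x hx, p.takeUntil x hx, fun y hy => hp y ?_⟩⟩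
  exact p.support_takeUntil_subset_support hx hy

/-- Stopping at the first visit of the final vertex. -/
theorem restrict_end (h : ConnIn H S u v) :
    ConnIn H (S ∩ ({v} ∪ {x | ConnIn H {v}ᶜ u x})) u v := by
  classical
  obtain ⟨p, hp, hS⟩ := h.exists_isPath
  refine ⟨p, fun x hx => ⟨hS x hx, ?_⟩⟩
  by_cases hxv : x = v
  · exact Or.inl hxv
  · refine Or.inr ⟨p.takeUntil x hx, fun y hy => ?_⟩
    rintro rfl
    exact Walk.endpoint_notMem_support_takeUntil hp hx (Ne.symm hxv) hy

/-- A walk leaving the set `T` crosses an edge from `T` to its complement. -/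
theorem exists_boundary (h : ConnIn H S u v) (hu : u ∈ T) (hv : v ∉ T) :
    ∃ x y, H.Adj x y ∧ x ∈ S ∧ y ∈ S ∧ x ∈ T ∧ y ∉ T := by
  obtain ⟨p, hp⟩ := h
  obtain ⟨e, he, h1, h2⟩ := p.exists_boundary_dart T hu hv
  exact ⟨e.fst, e.snd, e.adj, hp _ (p.dart_fst_mem_support_of_mem_darts he),
    hp _ (p.dart_snd_mem_support_of_mem_darts he), h1, h2⟩

/-- Trimming a walk between two sets so that it meets them only at its ends. -/
theorem exists_trim {A B : Set V} (h : ConnIn H S u v) (hu : u ∈ A) (hv : v ∈ B) :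
    ∃ a ∈ A, ∃ b ∈ B, ∃ p : H.Walk a b, p.IsPath ∧ (∀ x ∈ p.support, x ∈ S) ∧
      (∀ x ∈ p.support, x ∈ A → x = a) ∧ ∀ x ∈ p.support, x ∈ B → x = b := by
  classical
  obtain ⟨p, hp⟩ := h
  generalize hn : p.length = n
  induction n using Nat.strong_induction_on generalizing u v with
  | _ n ih =>
    by_cases h1 : ∀ x ∈ p.support, x ∈ A → x = u
    · by_cases h2 : ∀ x ∈ p.support, x ∈ B → x = v
      · refine ⟨u, hu, v, hv, p.bypass, p.bypass_isPath, ?_, ?_, ?_⟩ <;> intro x hx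
        exacts [hp x (p.support_bypass_subset_support hx),
          h1 x (p.support_bypass_subset_support hx), h2 x (p.support_bypass_subset_support hx)]
      · push Not at h2
        obtain ⟨x, hx, hxB, hne⟩ := h2
        exact ih _ (by rw [← hn]; exact p.length_takeUntil_lt_length hx hne) hu hxB (p.takeUntil x hx)
          (fun y hy => hp y (p.support_takeUntil_subset_support hx hy)) rfl
    · push Not at h1
      obtain ⟨x, hx, hxA, hne⟩ := h1
      refine ih _ ?_ hxA hv (p.dropUntil x hx)
          (fun y hy => hp y (p.support_dropUntil_subset_support hx hy)) rfl
      have h3 := congrArg Walk.length (p.take_spec hx)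
      rw [Walk.length_append] at h3
      have h4 : (p.takeUntil x hx).length ≠ 0 := fun h0 => hne (Walk.eq_of_length_eq_zero h0).symm
      omega

end ConnIn

/-! ### Menger's theorem for two paths -/

/-- One side of the inductive step: c separates A from B once the edge xy is deleted. A vertex z
separating A from {c, x} in H' would separate A from B in H: what A reaches in H' - z misses c,
hence stays on the A-side of c, and xy gives no exit from it. -/
theorem menger_two_half {H H' : SimpleGraph V} {A B : Set V} {c x y : V}
    (hadj : ∀ u v, H.Adj u v → ¬ H'.Adj u v → s(u, v) = s(x, y))
    (hA : ∀ z, ∃ a ∈ A, ∃ b ∈ B, ConnIn H {z}ᶜ a b)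
    (hc : ∀ a ∈ A, ∀ b ∈ B, ¬ ConnIn H' {c}ᶜ a b)
    (hx : ∃ a ∈ A, ConnIn H' {c}ᶜ a x) (hy : ∃ b ∈ B, ConnIn H' {c}ᶜ b y)
    (ih : ∀ A B : Set V, (∀ z, ∃ a ∈ A, ∃ b ∈ B, ConnIn H' {z}ᶜ a b) →
      ∃ S T : Set V, Disjoint S T ∧ (∃ a ∈ A, ∃ b ∈ B, ConnIn H' S a b) ∧
        ∃ a ∈ A, ∃ b ∈ B, ConnIn H' T a b) :
    ∃ S T : Set V, Disjoint S T ∧ (∃ a ∈ A, ConnIn H' S a c) ∧ (∃ a ∈ A, ConnIn H' T a x) ∧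
      S ⊆ {c} ∪ {v | ∃ a ∈ A, ConnIn H' {c}ᶜ a v} ∧ T ⊆ {v | ∃ a ∈ A, ConnIn H' {c}ᶜ a v} := by
  have key : ∀ z, ∃ a ∈ A, ∃ b ∈ ({c, x} : Set V), ConnIn H' {z}ᶜ a b := by
    intro z
    by_contra hz
    push Not at hz
    have hzc : ∀ v, (∃ a ∈ A, ConnIn H' {z}ᶜ a v) → ∃ a ∈ A, ConnIn H' {c}ᶜ a v := by
      rintro v ⟨a, ha, hav⟩
      refine ⟨a, ha, hav.restrict.mono le_rfl ?_⟩
      rintro w ⟨-, hw⟩ rfl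
      exact hz a ha w (by simp) hw
    obtain ⟨a, ha, b, hb, hab⟩ := hA z
    by_cases hbT : ∃ a ∈ A, ConnIn H' {z}ᶜ a b
    · obtain ⟨a', ha', h⟩ := hzc b hbT
      exact hc a' ha' b hb h
    · obtain ⟨u, w, huw, hu, hw, huT, hwT⟩ :=
        hab.exists_boundary (T := {v | ∃ a ∈ A, ConnIn H' {z}ᶜ a v}) ⟨a, ha, .refl hab.left_mem⟩ hbT
      have hnot : ¬ H'.Adj u w := by
        intro h
        obtain ⟨a', ha', h'⟩ := huT
        exact hwT ⟨a', ha', h'.trans (.of_adj h hu hw)⟩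
      have := hadj u w huw hnot
      rw [Sym2.eq_iff] at this
      rcases this with ⟨rfl, -⟩ | ⟨rfl, -⟩
      · obtain ⟨a', ha', h'⟩ := huT
        exact hz a' ha' _ (by simp) h'
      · obtain ⟨a', ha', h'⟩ := hzc _ huT
        obtain ⟨b', hb', h''⟩ := hy
        exact hc a' ha' b' hb' (h'.trans h''.symm)
  obtain ⟨S, T, hST, ⟨a₁, ha₁, b₁, hb₁, h₁⟩, a₂, ha₂, b₂, hb₂, h₂⟩ := ih A {c, x} key
  -- Both walks stay on the A-side: one is stopped at its first visit to c, and the other misses c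
  -- because c lies in the disjoint set S.
  have fin : ∀ S T : Set V, Disjoint S T → ∀ a₁ ∈ A, ∀ a₂ ∈ A, ConnIn H' S a₁ c →
      ConnIn H' T a₂ x → ∃ S T : Set V, Disjoint S T ∧ (∃ a ∈ A, ConnIn H' S a c) ∧
        (∃ a ∈ A, ConnIn H' T a x) ∧ S ⊆ {c} ∪ {v | ∃ a ∈ A, ConnIn H' {c}ᶜ a v} ∧
        T ⊆ {v | ∃ a ∈ A, ConnIn H' {c}ᶜ a v} := by
    intro S T hST a₁ ha₁ a₂ ha₂ h₁ h₂
    refine ⟨_, _, ?_, ⟨a₁, ha₁, h₁.restrict_end⟩, ⟨a₂, ha₂, h₂.restrict⟩, ?_, ?_⟩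
    · exact hST.mono Set.inter_subset_left Set.inter_subset_left
    · rintro v ⟨-, hv | hv⟩
      exacts [Or.inl hv, Or.inr ⟨a₁, ha₁, hv⟩]
    · rintro v ⟨-, hv⟩
      refine ⟨a₂, ha₂, hv.mono le_rfl ?_⟩
      rintro w hw rfl
      exact Set.disjoint_left.1 hST h₁.right_mem hw
  have hne : b₁ ≠ b₂ := by
    rintro rfl
    exact Set.disjoint_left.1 hST h₁.right_mem h₂.right_mem
  rcases hb₁ with rfl | rfl <;> rcases hb₂ with rfl | rfl
  · exact absurd rfl hne
  · exact fin S T hST a₁ ha₁ a₂ ha₂ h₁ h₂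
  · exact fin T S hST.symm a₂ ha₂ a₁ ha₁ h₂ h₁
  · exact absurd rfl hne

/-- Menger's theorem for two paths: if no single vertex separates `A` from `B`, there are two
vertex-disjoint walks from `A` to `B`. -/
theorem menger_two [Finite V] [Nonempty V] (H : SimpleGraph V) (A B : Set V)
    (hAB : ∀ z, ∃ a ∈ A, ∃ b ∈ B, ConnIn H {z}ᶜ a b) :
    ∃ S T : Set V, Disjoint S T ∧ (∃ a ∈ A, ∃ b ∈ B, ConnIn H S a b) ∧
      ∃ a ∈ A, ∃ b ∈ B, ConnIn H T a b := by
  induction H using WellFoundedLT.induction generalizing A B with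
  | _ H ih =>
    by_cases hE : ∃ x y, H.Adj x y
    · obtain ⟨x₀, y₀, h₀⟩ := hE
      set H' := H.deleteEdges {s(x₀, y₀)} with hH'
      have hlt : H' < H := by
        refine lt_of_le_of_ne (deleteEdges_le _) fun h => ?_
        have : H'.Adj x₀ y₀ := h ▸ h₀
        simp [hH'] at this
      by_cases hsep : ∀ z, ∃ a ∈ A, ∃ b ∈ B, ConnIn H' {z}ᶜ a b
      · obtain ⟨S, T, hST, ⟨a, ha, b, hb, h⟩, a', ha', b', hb', h'⟩ := ih H' hlt A B hsep
        exact ⟨S, T, hST, ⟨a, ha, b, hb, h.mono hlt.le le_rfl⟩,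
          a', ha', b', hb', h'.mono hlt.le le_rfl⟩
      push Not at hsep
      obtain ⟨c, hc⟩ := hsep
      have hadj₀ : ∀ u v, H.Adj u v → ¬ H'.Adj u v → s(u, v) = s(x₀, y₀) := by
        intro u v h h'
        by_contra hne
        exact h' (by rw [hH', deleteEdges_adj]; exact ⟨h, hne⟩)
      -- An H-walk from A to B avoiding c can leave the A-side, and enter the B-side, only across
      -- the deleted edge; this orients it as xy.
      have hxy : ∃ x y, s(x, y) = s(x₀, y₀) ∧ (∃ a ∈ A, ConnIn H' {c}ᶜ a x) ∧
          ∃ b ∈ B, ConnIn H' {c}ᶜ b y := by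
        obtain ⟨a, ha, b, hb, hab⟩ := hAB c
        obtain ⟨x, y, hadj, hx, hy, hxT, hyT⟩ :=
          hab.exists_boundary (T := {v | ∃ a ∈ A, ConnIn H' {c}ᶜ a v})
            ⟨a, ha, .refl hab.left_mem⟩ fun ⟨a', ha', h⟩ => hc a' ha' b hb h
        obtain ⟨y', x', hadj', hy', hx', hyT', hxT'⟩ :=
          hab.symm.exists_boundary (T := {v | ∃ b ∈ B, ConnIn H' {c}ᶜ b v})
            ⟨b, hb, .refl hab.right_mem⟩ fun ⟨b', hb', h⟩ => hc a ha b' hb' h.symm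
        have e1 : s(x, y) = s(x₀, y₀) := hadj₀ x y hadj fun h => by
          obtain ⟨a', ha', h'⟩ := hxT
          exact hyT ⟨a', ha', h'.trans (.of_adj h hx hy)⟩
        have e2 : s(y', x') = s(x₀, y₀) := hadj₀ y' x' hadj' fun h => by
          obtain ⟨b', hb', h'⟩ := hyT'
          exact hxT' ⟨b', hb', h'.trans (.of_adj h hy' hx')⟩
        have e3 := e1.trans e2.symm
        rw [Sym2.eq_iff] at e3
        rcases e3 with ⟨rfl, rfl⟩ | ⟨rfl, rfl⟩
        · obtain ⟨a', ha', h'⟩ := hxT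
          obtain ⟨b', hb', h''⟩ := hyT'
          exact absurd (h'.trans h''.symm) (hc a' ha' b' hb')
        · exact ⟨x, y, e1, hxT, hyT'⟩
      obtain ⟨x, y, hxy, hx, hy⟩ := hxy
      rw [← hxy] at hadj₀
      have hxyH : H.Adj x y := by
        rw [← mem_edgeSet, hxy]
        exact h₀
      obtain ⟨U₁, U₂, hU, ⟨a₁, ha₁, hU₁⟩, ⟨a₂, ha₂, hU₂⟩, sU₁, sU₂⟩ :=
        menger_two_half hadj₀ hAB hc hx hy (ih H' hlt)
      obtain ⟨W₁, W₂, hW, ⟨b₁, hb₁, hW₁⟩, ⟨b₂, hb₂, hW₂⟩, sW₁, sW₂⟩ :=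
        menger_two_half (A := B) (B := A) (x := y) (y := x)
          (fun u v h h' => (hadj₀ u v h h').trans Sym2.eq_swap)
          (fun z => by
            obtain ⟨a, ha, b, hb, h⟩ := hAB z
            exact ⟨b, hb, a, ha, h.symm⟩)
          (fun b hb a ha h => hc a ha b hb h.symm) hy hx (ih H' hlt)
      have hsides : ∀ v, (∃ a ∈ A, ConnIn H' {c}ᶜ a v) → ¬ ∃ b ∈ B, ConnIn H' {c}ᶜ b v := by
        rintro v ⟨a, ha, h⟩ ⟨b, hb, h'⟩
        exact hc a ha b hb (h.trans h'.symm)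
      have hcA : ¬ ∃ a ∈ A, ConnIn H' {c}ᶜ a c := fun ⟨a, _, h⟩ => h.right_mem rfl
      have hcB : ¬ ∃ b ∈ B, ConnIn H' {c}ᶜ b c := fun ⟨a, _, h⟩ => h.right_mem rfl
      -- One walk is glued at c, the other across the edge xy. The two halves can only meet in c,
      -- which lies in U₁ and W₁ alone.
      refine ⟨U₁ ∪ W₁, U₂ ∪ W₂, ?_, ⟨a₁, ha₁, b₁, hb₁, ?_⟩, a₂, ha₂, b₂, hb₂, ?_⟩
      · rw [Set.disjoint_left]
        rintro v (hv | hv) (hv' | hv')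
        · exact Set.disjoint_left.1 hU hv hv'
        · rcases sU₁ hv with rfl | h
          · exact hcB (sW₂ hv')
          · exact hsides v h (sW₂ hv')
        · rcases sW₁ hv with rfl | h
          · exact hcA (sU₂ hv')
          · exact hsides v (sU₂ hv') h
        · exact Set.disjoint_left.1 hW hv hv'
      · exact (hU₁.mono hlt.le Set.subset_union_left).trans
          (hW₁.symm.mono hlt.le Set.subset_union_right)
      · exact ((hU₂.mono hlt.le Set.subset_union_left).trans
          (.of_adj hxyH (Or.inl hU₂.right_mem) (Or.inr hW₂.right_mem))).trans
          (hW₂.symm.mono hlt.le Set.subset_union_right)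
    -- Without edges every walk is constant, so A ∩ B contains a vertex a and, taking z = a, another
    -- one.
    · have heq : ∀ {S : Set V} {a b : V}, ConnIn H S a b → a = b := by
        rintro S a b ⟨p, -⟩
        cases p with
        | nil => rfl
        | cons h _ => exact absurd ⟨_, _, h⟩ hE
      obtain ⟨a, ha, b, hb, h⟩ := hAB (Classical.arbitrary V)
      obtain rfl := heq h
      obtain ⟨a', ha', b', hb', h'⟩ := hAB a
      obtain rfl := heq h'
      refine ⟨{a}, {a'}, ?_, ⟨a, ha, a, hb, .refl rfl⟩, a', ha', a', hb', .refl rfl⟩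
      exact Set.disjoint_singleton.2 (Ne.symm h'.left_mem)

/-! ### High connectivity and vertex removal -/

/-- Deleting fewer than `s` vertices does not disconnect the non-isolated vertices of `H`. -/
def SConn (s : ℕ) (H : SimpleGraph V) : Prop :=
  ∀ W : Set V, W.ncard < s → ∀ u ∈ H.support, ∀ v ∈ H.support, u ∉ W → v ∉ W → ConnIn H Wᶜ u v

/-- The graph `H` with the vertices in `U` isolated. -/
def isolate (H : SimpleGraph V) (U : Set V) : SimpleGraph V where
  Adj a b := H.Adj a b ∧ a ∉ U ∧ b ∉ U
  symm := ⟨fun _ _ h => ⟨h.1.symm, h.2.2, h.2.1⟩⟩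
  loopless := ⟨fun _ h => h.1.ne rfl⟩

theorem isolate_le (H : SimpleGraph V) (U : Set V) : H.isolate U ≤ H := fun _ _ h => h.1

theorem isolate_inter_support (H : SimpleGraph V) (U : Set V) :
    H.isolate (U ∩ H.support) = H.isolate U := by
  ext a b
  constructor
  · rintro ⟨h, ha, hb⟩
    exact ⟨h, fun h' => ha ⟨h', h.mem_support_left⟩, fun h' => hb ⟨h', h.mem_support_right⟩⟩
  · rintro ⟨h, ha, hb⟩
    exact ⟨h, fun h' => ha h'.1, fun h' => hb h'.1⟩

theorem isolate_mono {H H' : SimpleGraph V} (h : H ≤ H') (U : Set V) :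
    H.isolate U ≤ H'.isolate U := fun _ _ h' => ⟨h h'.1, h'.2⟩

theorem support_isolate_subset (H : SimpleGraph V) (U : Set V) :
    (H.isolate U).support ⊆ H.support \ U := by
  rintro v ⟨w, h⟩
  exact ⟨h.1.mem_support_left, h.2.1⟩

/-- Only the trivial walk can sit at an isolated vertex. Through this, paths in `H.isolate U` with
distinct ends are seen to avoid U. -/
theorem Walk.mem_support_graph_of_ne {H : SimpleGraph V} {u v : V} (p : H.Walk u v) (h : u ≠ v)
    {x : V} (hx : x ∈ p.support) : x ∈ H.support := by
  induction p with
  | nil => exact absurd rfl h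
  | @cons u w v hadj p ih =>
    rw [Walk.support_cons, List.mem_cons] at hx
    rcases hx with rfl | hx
    · exact hadj.mem_support_left
    · by_cases hwv : w = v
      · subst hwv
        cases p with
        | nil => rw [Walk.support_nil, List.mem_singleton] at hx; exact hx ▸ hadj.mem_support_right
        | cons h' p' =>
          by_cases hxw : x = w
          · exact hxw ▸ hadj.mem_support_right
          · rw [Walk.support_cons, List.mem_cons] at hx
            rcases hx with hx | hx
            · exact absurd hx hxw
            · classical
              have : (p'.dropUntil x hx).length ≠ 0 :=
                fun h0 => hxw (Walk.eq_of_length_eq_zero h0)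
              cases hq : p'.dropUntil x hx with
              | nil => exact absurd rfl hxw
              | cons h'' _ => exact h''.mem_support_left
      · exact ih hwv hx

theorem ConnIn.isolate {H : SimpleGraph V} {S U : Set V} {u v : V} (h : ConnIn H S u v)
    (hSU : Disjoint S U) : ConnIn (H.isolate U) S u v := by
  obtain ⟨p, hp⟩ := h
  induction p with
  | nil => exact .refl (hp _ (by simp))
  | @cons u w v hadj p ih =>
    have hu : u ∈ S := hp _ (by simp)
    have hw : w ∈ S := hp _ (by simp)
    exact (ConnIn.of_adj (H := H.isolate U) ⟨hadj, Set.disjoint_left.1 hSU hu,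
      Set.disjoint_left.1 hSU hw⟩ hu hw).trans (ih fun x hx => hp x (by simp [hx]))

theorem ConnIn.exists_adj {H : SimpleGraph V} {S : Set V} {u v : V} (h : ConnIn H S u v)
    (hne : u ≠ v) : ∃ w ∈ S, H.Adj u w := by
  obtain ⟨p, hp⟩ := h
  cases p with
  | nil => exact absurd rfl hne
  | cons hadj p => exact ⟨_, hp _ (by simp), hadj⟩

namespace SConn

variable {s t : ℕ} {H H' : SimpleGraph V}

theorem mono (h : SConn s H) (hts : t ≤ s) : SConn t H := fun W hW => h W (hW.trans_le hts)

/-- A deleted set of fewer than s vertices spares some common vertex z, and every surviving vertex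
of either graph is still joined to z. -/
theorem sup [Finite V] (h : SConn s H) (h' : SConn s H')
    (hs : s ≤ (H.support ∩ H'.support).ncard) : SConn s (H ⊔ H') := by
  intro W hW u hu v hv huW hvW
  obtain ⟨z, ⟨hz, hz'⟩, hzW⟩ := Set.exists_mem_notMem_of_ncard_lt_ncard (hW.trans_le hs)
  have key : ∀ u ∈ (H ⊔ H').support, u ∉ W → ConnIn (H ⊔ H') Wᶜ u z := by
    rintro u ⟨w, hw | hw⟩ huW
    · exact (h W hW u hw.mem_support_left z hz huW hzW).mono le_sup_left le_rfl
    · exact (h' W hW u hw.mem_support_left z hz' huW hzW).mono le_sup_right le_rfl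
  exact (key u hu huW).trans (key v hv hvW).symm

theorem isolate [Finite V] (h : SConn s H) {U : Set V} (hU : (U ∩ H.support).ncard + t ≤ s) :
    SConn t (H.isolate U) := by
  rw [← isolate_inter_support]
  intro W hW u hu v hv huW hvW
  have hu' := support_isolate_subset _ _ hu
  have hv' := support_isolate_subset _ _ hv
  have hlt : (W ∪ U ∩ H.support).ncard < s :=
    (Set.ncard_union_le _ _).trans_lt (by omega)
  have h1 := h _ hlt u hu'.1 v hv'.1 (by simp_all) (by simp_all)
  refine (h1.isolate (U := U ∩ H.support) ?_).mono le_rfl ?_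
  · exact Set.disjoint_left.2 fun x hx hx' => hx (Or.inr hx')
  · exact fun x hx hx' => hx (Or.inl hx')

/-- No surviving vertex becomes isolated: it is joined outside U to another survivor, so it keeps a
neighbour there. -/
theorem support_isolate [Finite V] (h : SConn s H) {U : Set V} (hU : (U ∩ H.support).ncard < s)
    (hcard : (U ∩ H.support).ncard + 2 ≤ H.support.ncard) :
    (H.isolate U).support = H.support \ U := by
  refine (support_isolate_subset H U).antisymm ?_
  rintro u ⟨hu, huU⟩
  have : (insert u (U ∩ H.support)).ncard < H.support.ncard :=
    (Set.ncard_insert_le _ _).trans_lt (by omega)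
  obtain ⟨v, hv, hv'⟩ := Set.exists_mem_notMem_of_ncard_lt_ncard this
  rw [Set.mem_insert_iff, not_or] at hv'
  obtain ⟨w, hw, hadj⟩ := (h _ hU u hu v hv (fun h' => huU h'.1) hv'.2).exists_adj (Ne.symm hv'.1)
  exact ⟨w, hadj, huU, fun h' => hw ⟨h', hadj.mem_support_right⟩⟩

theorem ncard_support_isolate [Finite V] (h : SConn s H) {U : Set V}
    (hU : (U ∩ H.support).ncard < s) (hcard : (U ∩ H.support).ncard + 2 ≤ H.support.ncard) :
    H.support.ncard ≤ (H.isolate U).support.ncard + (U ∩ H.support).ncard := by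
  rw [h.support_isolate hU hcard]
  calc H.support.ncard ≤ ((H.support \ U) ∪ (U ∩ H.support)).ncard :=
        Set.ncard_le_ncard fun x hx => by
          by_cases hxU : x ∈ U
          exacts [Or.inr ⟨hxU, hx⟩, Or.inl ⟨hx, hxU⟩]
    _ ≤ _ := Set.ncard_union_le _ _

end SConn

/-! ### Long paths and detours -/

theorem Walk.IsPath.append_of_inter {H : SimpleGraph V} {u v w : V} {p : H.Walk u v}
    {q : H.Walk v w} (hp : p.IsPath) (hq : q.IsPath)
    (h : ∀ x ∈ p.support, x ∈ q.support → x = v) : (p.append q).IsPath := by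
  rw [Walk.isPath_def, Walk.support_append]
  refine List.Nodup.append hp.support_nodup hq.support_nodup.tail ?_
  intro x hx hx'
  obtain rfl := h x hx (List.mem_of_mem_tail hx')
  have := hq.support_nodup
  rw [← Walk.cons_tail_support] at this
  exact (List.nodup_cons.1 this).1 hx'

theorem Walk.IsPath.ncard_support {H : SimpleGraph V} {u v : V} {p : H.Walk u v}
    (hp : p.IsPath) : {x | x ∈ p.support}.ncard = p.length + 1 := by
  classical
  rw [← Walk.length_support, ← List.toFinset_card_of_nodup hp.support_nodup,
    ← Set.ncard_coe_finset]
  congr 1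
  ext; simp

/-- In an `r`-connected graph any two vertices are joined by a path with at least `r` vertices. -/
theorem SConn.exists_long_path [Finite V] {r : ℕ} {R : SimpleGraph V} (h : SConn r R)
    (hr : 1 ≤ r) (hcard : r < R.support.ncard) {x y : V} (hx : x ∈ R.support) (hy : y ∈ R.support)
    (hxy : x ≠ y) : ∃ p : R.Walk x y, p.IsPath ∧ r ≤ p.length + 1 := by
  -- Greedy growth from x while avoiding y. Deleting y and all path vertices but the end z removes
  -- fewer than r vertices, so z is still joined to a vertex off the path and has a fresh neighbour.
  have start : ∀ j, j + 2 ≤ r → ∃ z ∈ R.support, ∃ p : R.Walk x z,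
      p.IsPath ∧ p.length = j ∧ y ∉ p.support := by
    intro j
    induction j with
    | zero => exact fun _ => ⟨x, hx, .nil, by simp, rfl, by simpa using hxy.symm⟩
    | succ j ih =>
      intro hj
      obtain ⟨z, hz, p, hp, hlen, hyp⟩ := ih (by omega)
      have hc := hp.ncard_support
      have hzp : z ∈ {x | x ∈ p.support} := p.end_mem_support
      have h1 : (insert y ({x | x ∈ p.support} \ {z})).ncard < r := by
        refine (Set.ncard_insert_le _ _).trans_lt ?_
        rw [Set.ncard_sdiff_singleton_of_mem hzp]
        omega
      have h2 : (insert y {x | x ∈ p.support}).ncard < R.support.ncard :=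
        (Set.ncard_insert_le _ _).trans_lt (by omega)
      obtain ⟨v, hv, hv'⟩ := Set.exists_mem_notMem_of_ncard_lt_ncard h2
      rw [Set.mem_insert_iff, not_or] at hv'
      have hzv : z ≠ v := fun e => hv'.2 (e ▸ hzp)
      have hzy : z ≠ y := fun e => hyp (e ▸ p.end_mem_support)
      obtain ⟨w, hw, hadj⟩ := (h _ h1 z hz v hv (by simp [hzy])
        (by rw [Set.mem_insert_iff, not_or]; exact ⟨hv'.1, fun h' => hv'.2 h'.1⟩)).exists_adj hzv
      rw [Set.mem_compl_iff, Set.mem_insert_iff, not_or] at hw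
      have hwp : w ∉ p.support := fun h' => hw.2 ⟨h', hadj.ne.symm⟩
      refine ⟨w, hadj.mem_support_right, p.concat hadj, hp.concat hwp hadj, by simp [hlen], ?_⟩
      rw [Walk.support_concat]
      simp [hyp, Ne.symm hw.1]
  by_cases hr2 : 2 ≤ r
  -- The path has r - 1 vertices; continuing to y off the path adds at least one more.
  · obtain ⟨z, hz, p, hp, hlen, hyp⟩ := start (r - 2) (by omega)
    have hc := hp.ncard_support
    have hzp : z ∈ {x | x ∈ p.support} := p.end_mem_support
    have h1 : ({x | x ∈ p.support} \ {z}).ncard < r := by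
      rw [Set.ncard_sdiff_singleton_of_mem hzp]
      omega
    have hzy : z ≠ y := fun e => hyp (e ▸ p.end_mem_support)
    obtain ⟨q, hq, hqS⟩ := (h _ h1 z hz y hy (by simp) (fun h' => hyp h'.1)).exists_isPath
    have hq0 : q.length ≠ 0 := fun h0 => hzy (Walk.eq_of_length_eq_zero h0)
    refine ⟨p.append q, hp.append_of_inter hq fun x hx hx' => ?_, ?_⟩
    · by_contra hne
      exact hqS x hx' ⟨hx, hne⟩
    · rw [Walk.length_append]
      omega
  · obtain ⟨q, hq, -⟩ := (h ∅ (by simp; omega) x hx y hy (by simp) (by simp)).exists_isPath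
    exact ⟨q, hq, by omega⟩

/-- Two disjoint paths ending in a highly connected graph `R` can be joined by a long detour. -/
theorem SConn.exists_bridge [Finite V] {r : ℕ} {H R : SimpleGraph V} (hRH : R ≤ H) (h : SConn r R)
    (hr : 1 ≤ r) (hcard : r < R.support.ncard) {a₁ a₂ r₁ r₂ : V} (hr₁ : r₁ ∈ R.support)
    (hr₂ : r₂ ∈ R.support) {p₁ : H.Walk a₁ r₁} {p₂ : H.Walk a₂ r₂} (hp₁ : p₁.IsPath)
    (hp₂ : p₂.IsPath) (hdisj : ∀ x ∈ p₁.support, x ∉ p₂.support)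
    (ht₁ : ∀ x ∈ p₁.support, x ∈ R.support → x = r₁)
    (ht₂ : ∀ x ∈ p₂.support, x ∈ R.support → x = r₂) :
    ∃ p : H.Walk a₁ a₂, p.IsPath ∧ p₁.length + p₂.length + r ≤ p.length + 1 ∧
      ∀ x ∈ p.support, x ∈ p₁.support ∨ x ∈ R.support ∨ x ∈ p₂.support := by
  have hne : r₁ ≠ r₂ := fun e => hdisj r₁ p₁.end_mem_support (e ▸ p₂.end_mem_support)
  obtain ⟨q, hq, hlen⟩ := h.exists_long_path hr hcard hr₁ hr₂ hne
  have hqR : ∀ x ∈ (q.mapLe hRH).support, x ∈ R.support := fun x hx =>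
    q.mem_support_graph_of_ne hne (by simpa using hx)
  have hq' : (q.mapLe hRH).IsPath := (Walk.isPath_mapLe hRH).2 hq
  refine ⟨p₁.append ((q.mapLe hRH).append p₂.reverse), ?_, ?_, ?_⟩
  · refine hp₁.append_of_inter (hq'.append_of_inter hp₂.reverse ?_) ?_
    · intro x hx hx'
      exact ht₂ x (by simpa using hx') (hqR x hx)
    · intro x hx hx'
      rcases (Walk.mem_support_append_iff _ _).1 hx' with h' | h'
      · exact ht₁ x hx (hqR x h')
      · exact absurd (by simpa using h') (hdisj x hx)
  · simp only [Walk.length_append, Walk.length_reverse, Walk.length_mapLe]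
    omega
  · intro x hx
    rcases (Walk.mem_support_append_iff _ _).1 hx with h' | h'
    · exact Or.inl h'
    rcases (Walk.mem_support_append_iff _ _).1 h' with h' | h'
    · exact Or.inr (Or.inl (hqR x h'))
    · exact Or.inr (Or.inr (by simpa using h'))

/-- In a 2-connected graph containing an `r`-connected subgraph, any two vertices are joined by a
path with at least `r` vertices. -/
theorem SConn.exists_path_through [Finite V] {r : ℕ} {H R : SimpleGraph V} (hH : SConn 2 H)
    (hRH : R ≤ H) (h : SConn r R) (hr : 1 ≤ r) (hcard : r < R.support.ncard) {x y : V}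
    (hx : x ∈ H.support) (hy : y ∈ H.support) (hxy : x ≠ y) :
    ∃ p : H.Walk x y, p.IsPath ∧ r ≤ p.length + 1 := by
  have : Nonempty V := ⟨x⟩
  have hsep : ∀ z, ∃ a ∈ ({x, y} : Set V), ∃ b ∈ R.support, ConnIn H {z}ᶜ a b := by
    intro z
    obtain ⟨b, hb, hbz⟩ := Set.exists_mem_notMem_of_ncard_lt_ncard
      (s := {z}) (t := R.support) (by rw [Set.ncard_singleton]; omega)
    have hbH := support_mono hRH hb
    by_cases hxz : x = z
    · exact ⟨y, by simp, b, hb, hH {z} (by simp) y hy b hbH (fun e => hxy (hxz.trans e.symm)) hbz⟩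
    · exact ⟨x, by simp, b, hb, hH {z} (by simp) x hx b hbH hxz hbz⟩
  obtain ⟨S, T, hST, ⟨a, ha, b, hb, hS⟩, a', ha', b', hb', hT⟩ := menger_two H _ _ hsep
  obtain ⟨a₁, ha₁, r₁, hr₁, p₁, hp₁, hp₁S, -, ht₁⟩ := hS.exists_trim ha hb
  obtain ⟨a₂, ha₂, r₂, hr₂, p₂, hp₂, hp₂T, -, ht₂⟩ := hT.exists_trim ha' hb'
  have hdisj : ∀ z ∈ p₁.support, z ∉ p₂.support := fun z hz hz' =>
    Set.disjoint_left.1 hST (hp₁S z hz) (hp₂T z hz')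
  have hne : a₁ ≠ a₂ := fun e => hdisj a₁ p₁.start_mem_support (e ▸ p₂.start_mem_support)
  obtain ⟨p, hp, hlen, -⟩ := h.exists_bridge hRH hr hcard hr₁ hr₂ hp₁ hp₂ hdisj ht₁ ht₂
  rcases ha₁ with rfl | rfl <;> rcases ha₂ with rfl | rfl
  · exact absurd rfl hne
  · exact ⟨p, hp, by omega⟩
  · exact ⟨p.reverse, hp.reverse, by rw [Walk.length_reverse]; omega⟩
  · exact absurd rfl hne

/-- The segment of P between positions i and j is replaced by D, which meets P only in its ends. -/
theorem Walk.IsPath.exists_reroute {H : SimpleGraph V} {u w : V} {P : H.Walk u w} (hP : P.IsPath)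
    {i j : ℕ} (hij : i < j) (hj : j ≤ P.length) {D : H.Walk (P.getVert i) (P.getVert j)}
    (hD : D.IsPath)
    (hDP : ∀ x ∈ D.support, x ∈ P.support → x = P.getVert i ∨ x = P.getVert j) :
    ∃ Q : H.Walk u w, Q.IsPath ∧ Q.length + (j - i) = P.length + D.length := by
  have htake : ∀ x ∈ (P.take i).support, x ∈ P.support ∧ ∃ m ≤ i, P.getVert m = x := by
    intro x hx
    obtain ⟨m, hm, hm'⟩ := Walk.mem_support_iff_exists_getVert.1 hx
    rw [Walk.take_getVert] at hm
    exact ⟨hm ▸ P.getVert_mem_support _, _, min_le_left _ _, hm⟩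
  have hdrop : ∀ x ∈ (P.drop j).support, x ∈ P.support ∧
      ∃ m, j ≤ m ∧ m ≤ P.length ∧ P.getVert m = x := by
    intro x hx
    obtain ⟨m, hm, hm'⟩ := Walk.mem_support_iff_exists_getVert.1 hx
    rw [Walk.drop_getVert] at hm
    rw [Walk.drop_length] at hm'
    exact ⟨hm ▸ P.getVert_mem_support _, _, Nat.le_add_right _ _, by omega, hm⟩
  have inj : ∀ m n, m ≤ P.length → n ≤ P.length → P.getVert m = P.getVert n → m = n :=
    fun m n hm hn h => hP.getVert_injOn hm hn h
  refine ⟨(P.take i).append (D.append (P.drop j)), ?_, ?_⟩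
  · refine (hP.take i).append_of_inter (hD.append_of_inter (hP.drop j) ?_) ?_
    · intro x hx hx'
      obtain ⟨hxP, m, hjm, hm, rfl⟩ := hdrop x hx'
      rcases hDP _ hx hxP with h | h
      · have := inj _ _ hm (by omega) h
        omega
      · exact h
    · intro x hx hx'
      obtain ⟨hxP, m, hmi, rfl⟩ := htake x hx
      rcases (Walk.mem_support_append_iff _ _).1 hx' with h | h
      · rcases hDP _ h hxP with h | h
        · exact h
        · have := inj _ _ (by omega) (by omega) h
          omega
      · obtain ⟨-, n, hjn, hn, h'⟩ := hdrop _ h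
        have := inj _ _ hn (by omega) h'
        omega
  · simp only [Walk.length_append, Walk.take_length, Walk.drop_length]
    omega

/-- A path avoiding a highly connected subgraph `R` of a connected enough graph can be lengthened
by a detour through `R`. -/
theorem SConn.exists_longer_path [Finite V] {s r g : ℕ} {H R : SimpleGraph V} (hH : SConn s H)
    (hRH : R ≤ H) (h : SConn r R) (hr : 1 ≤ r) (hcard : r < R.support.ncard) {u w : V}
    {P : H.Walk u w} (hP : P.IsPath) (hPR : ∀ x ∈ P.support, x ∉ R.support) (hg : 1 ≤ g)
    (hs : P.length / g + 1 < s) (hsR : s ≤ R.support.ncard) (hsP : s ≤ P.length) :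
    ∃ (u' w' : V) (Q : H.Walk u' w'), Q.IsPath ∧ P.length + r ≤ Q.length + g := by
  have : Nonempty V := ⟨u⟩
  -- P is cut into blocks of at most g consecutive vertices; there are fewer than s of them.
  let B : ℕ → Set V := fun j => {x | ∃ i ≤ P.length, i / g = j ∧ P.getVert i = x}
  let X : Set V := {x | x ∈ P.support}
  have hBX : ∀ j, B j ⊆ X := by
    rintro j x ⟨i, -, -, rfl⟩
    exact P.getVert_mem_support i
  -- Some block receives two disjoint paths from R that avoid the rest of P. Otherwise each block j
  -- is cut off from R by one vertex c j. These are fewer than s vertices, so some path from R to P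
  -- avoids them all; stopped at its first vertex on P, it contradicts the choice of c for that
  -- block.
  have hblock : ∃ j, ∀ z, ∃ a ∈ R.support, ∃ b ∈ B j, ConnIn (H.isolate (X \ B j)) {z}ᶜ a b := by
    by_contra hcon
    push Not at hcon
    choose c hc using hcon
    let W : Set V := c '' Set.Iic (P.length / g)
    have hWcard : W.ncard ≤ P.length / g + 1 := by
      refine (Set.ncard_image_le (Set.finite_Iic _)).trans ?_
      rw [← Finset.coe_Iic, Set.ncard_coe_finset, Nat.card_Iic]
    have hXcard : X.ncard = P.length + 1 := hP.ncard_support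
    obtain ⟨a, ha, haW⟩ := Set.exists_mem_notMem_of_ncard_lt_ncard
      (s := W) (t := R.support) (by omega)
    obtain ⟨b, hb, hbW⟩ := Set.exists_mem_notMem_of_ncard_lt_ncard (s := W) (t := X) (by omega)
    have huw : u ≠ w := by
      rintro rfl
      have := Walk.length_eq_zero_iff.2 (Walk.isPath_iff_nil.1 hP)
      omega
    have hbH : b ∈ H.support := P.mem_support_graph_of_ne huw hb
    obtain ⟨a', ha', b', hb', p, hp, hpW, -, hpX⟩ :=
      (hH W (by omega) a (support_mono hRH ha) b hbH haW hbW).exists_trim ha hb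
    obtain ⟨i, hi, hi'⟩ := Walk.mem_support_iff_exists_getVert.1 hb'
    have hpc : ConnIn H ((Wᶜ ∩ (Xᶜ ∪ {b'})) : Set V) a' b' := by
      refine ⟨p, fun x hx => ⟨hpW x hx, ?_⟩⟩
      by_cases hxX : x ∈ X
      · exact Or.inr (hpX x hx hxX)
      · exact Or.inl hxX
    have hb'B : b' ∈ B (i / g) := ⟨i, hi', rfl, hi⟩
    refine hc (i / g) a' ha' b' hb'B ((hpc.isolate ?_).mono le_rfl ?_)
    · rw [Set.disjoint_left]
      rintro x ⟨-, hx | rfl⟩ hx'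
      exacts [hx hx'.1, hx'.2 hb'B]
    · rintro x ⟨hx, -⟩ rfl
      exact hx ⟨i / g, Nat.div_le_div_right hi', rfl⟩
  obtain ⟨j, hj⟩ := hblock
  obtain ⟨S, T, hST, ⟨a, ha, b, hb, hS⟩, a', ha', b', hb', hT⟩ := menger_two _ _ _ hj
  obtain ⟨r₁, hr₁, b₁, hb₁, p₁, hp₁, hp₁S, hr₁', ht₁⟩ := hS.exists_trim ha hb
  obtain ⟨r₂, hr₂, b₂, hb₂, p₂, hp₂, hp₂T, hr₂', ht₂⟩ := hT.exists_trim ha' hb'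
  have hle := isolate_le H (X \ B j)
  have hmeet : ∀ {r₁ b₁ : V} (p : (H.isolate (X \ B j)).Walk r₁ b₁), r₁ ∈ R.support → b₁ ∈ B j →
      (∀ x ∈ p.support, x ∈ B j → x = b₁) → ∀ x ∈ p.support, x ∈ X → x = b₁ := by
    intro r₁ b₁ p hr hb hp x hx hxX
    have hne : r₁ ≠ b₁ := fun e => hPR _ (hBX j hb) (e ▸ hr)
    by_cases hxB : x ∈ B j
    · exact hp x hx hxB
    · exact absurd ⟨hxX, hxB⟩ (support_isolate_subset _ _ (p.mem_support_graph_of_ne hne hx)).2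
  have hm₁ := hmeet p₁ hr₁ hb₁ ht₁
  have hm₂ := hmeet p₂ hr₂ hb₂ ht₂
  have hdisj : ∀ z ∈ p₁.support, z ∉ p₂.support := fun z hz hz' =>
    Set.disjoint_left.1 hST (hp₁S z hz) (hp₂T z hz')
  obtain ⟨D, hD, hDlen, hDsup⟩ := h.exists_bridge hRH hr hcard hr₁ hr₂
    (p₁ := (p₁.mapLe hle).reverse) (p₂ := (p₂.mapLe hle).reverse)
    ((Walk.isPath_mapLe hle).2 hp₁).reverse ((Walk.isPath_mapLe hle).2 hp₂).reverse
    (by simpa using hdisj) (by simpa using hr₁') (by simpa using hr₂')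
  have hDP : ∀ x ∈ D.support, x ∈ P.support → x = b₁ ∨ x = b₂ := by
    intro x hx hxP
    rcases hDsup x hx with h' | h' | h'
    · exact Or.inl (hm₁ x (by simpa using h') hxP)
    · exact absurd h' (hPR x hxP)
    · exact Or.inr (hm₂ x (by simpa using h') hxP)
  have hbne : b₁ ≠ b₂ := fun e => hdisj b₁ p₁.end_mem_support (e ▸ p₂.end_mem_support)
  clear hDsup hm₁ hm₂ hdisj
  obtain ⟨i₁, hi₁, hij₁, rfl⟩ := hb₁
  obtain ⟨i₂, hi₂, hij₂, rfl⟩ := hb₂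
  -- Two positions in one block differ by less than g, so the detour costs fewer than g edges of P.
  have hgap : ∀ i i', i / g = j → i' / g = j → i' < i + g := by
    intro i i' h1 h2
    have e1 := Nat.div_add_mod i g
    have e2 := Nat.div_add_mod i' g
    have e3 := Nat.mod_lt i' (show 0 < g by omega)
    rw [h1] at e1
    rw [h2] at e2
    omega
  rcases lt_trichotomy i₁ i₂ with hlt | heq | hlt
  · obtain ⟨Q, hQ, hQlen⟩ := hP.exists_reroute hlt hi₂ hD hDP
    have := hgap i₁ i₂ hij₁ hij₂
    exact ⟨u, w, Q, hQ, by omega⟩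
  · exact absurd (by rw [heq]) hbne
  · obtain ⟨Q, hQ, hQlen⟩ := hP.exists_reroute hlt hi₁ hD.reverse
      (fun x hx hxP => (hDP x (by simpa using hx) hxP).symm)
    rw [Walk.length_reverse] at hQlen
    have := hgap i₂ i₁ hij₂ hij₁
    exact ⟨u, w, Q, hQ, by omega⟩

/-! ### Mader's theorem -/

theorem ncard_edgeSet_isolate_compl_le [Finite V] (G : SimpleGraph V) (X : Set V) :
    2 * (G.isolate Xᶜ).edgeSet.ncard ≤ X.ncard * X.ncard := by
  classical
  have := Fintype.ofFinite V
  have hsub : (G.isolate Xᶜ).edgeSet ⊆ (X.toFinset.offDiag.image Sym2.mk.uncurry : Finset (Sym2 V)) := by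
    intro e
    induction e with
    | _ a b =>
      intro h
      have h' : (G.isolate Xᶜ).Adj a b := h
      simp only [Finset.coe_image, Set.mem_image]
      refine ⟨(a, b), ?_, rfl⟩
      simpa [Finset.mem_offDiag, h'.ne] using h'.2
  have h1 := Set.ncard_le_ncard hsub
  rw [Set.ncard_coe_finset, Sym2.card_image_offDiag, ← Set.ncard_eq_toFinset_card'] at h1
  have h2 := Nat.choose_two_right X.ncard
  have h3 := Nat.div_mul_le_self (X.ncard * (X.ncard - 1)) 2
  have h4 : X.ncard * (X.ncard - 1) ≤ X.ncard * X.ncard := Nat.mul_le_mul_left _ (Nat.sub_le _ _)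
  omega

theorem ncard_edgeSet_isolate_le_union [Finite V] (G : SimpleGraph V) {X X₁ X₂ : Set V}
    (h : ∀ x y, G.Adj x y → x ∈ X → y ∈ X → x ∈ X₁ ∧ y ∈ X₁ ∨ x ∈ X₂ ∧ y ∈ X₂) :
    (G.isolate Xᶜ).edgeSet.ncard ≤
      (G.isolate X₁ᶜ).edgeSet.ncard + (G.isolate X₂ᶜ).edgeSet.ncard := by
  refine le_trans (Set.ncard_le_ncard ?_) (Set.ncard_union_le _ _)
  intro e
  induction e with
  | _ a b =>
    rintro ⟨hab, ha, hb⟩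
    rw [Set.notMem_compl_iff] at ha hb
    rcases h a b hab ha hb with h' | h'
    · exact Or.inl ⟨hab, not_not.2 h'.1, not_not.2 h'.2⟩
    · exact Or.inr ⟨hab, not_not.2 h'.1, not_not.2 h'.2⟩

theorem ncard_edgeSet_isolate_le_diff_singleton [Finite V] (G : SimpleGraph V) (X : Set V) (v : V) :
    (G.isolate Xᶜ).edgeSet.ncard ≤
      (G.isolate (X \ {v})ᶜ).edgeSet.ncard + {w | w ∈ X ∧ G.Adj v w}.ncard := by
  refine le_trans (Set.ncard_le_ncard (t := (G.isolate (X \ {v})ᶜ).edgeSet ∪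
    (fun w => s(v, w)) '' {w | w ∈ X ∧ G.Adj v w}) ?_) ((Set.ncard_union_le _ _).trans
      (Nat.add_le_add_left (Set.ncard_image_le (Set.toFinite _)) _))
  intro e
  induction e with
  | _ a b =>
    rintro ⟨hab, ha, hb⟩
    rw [Set.notMem_compl_iff] at ha hb
    by_cases hav : a = v
    · exact Or.inr ⟨b, ⟨hb, hav ▸ hab⟩, by rw [hav]⟩
    by_cases hbv : b = v
    · exact Or.inr ⟨a, ⟨ha, hbv ▸ hab.symm⟩, by rw [hbv]; exact Sym2.eq_swap⟩
    · exact Or.inl ⟨hab, not_not.2 ⟨ha, hav⟩, not_not.2 ⟨hb, hbv⟩⟩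

/-- Mader's theorem: a graph with many edges contains a highly connected subgraph. -/
theorem exists_sConn_subgraph [Finite V] (G : SimpleGraph V) {k : ℕ}
    {X₀ : Set V} (hX₀ : G.support ⊆ X₀) (hG : 2 * k * X₀.ncard < G.edgeSet.ncard) :
    ∃ R ≤ G, SConn k R ∧ 2 * k < R.support.ncard ∧ k * R.support.ncard ≤ R.edgeSet.ncard := by
  classical
  -- The condition is e(G[X]) > 2k(|X| - k) with |X| ≥ 2k, written without subtraction. A smallest
  -- such X induces the required subgraph.
  let good : Set V → Prop := fun X =>
    2 * k ≤ X.ncard ∧ 2 * k * X.ncard < (G.isolate Xᶜ).edgeSet.ncard + 2 * k * k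
  have hgood₀ : good X₀ := by
    have heq : G.isolate X₀ᶜ = G := by
      ext a b
      refine ⟨fun h => h.1, fun h => ⟨h, ?_, ?_⟩⟩
      · exact not_not.2 (hX₀ h.mem_support_left)
      · exact not_not.2 (hX₀ h.mem_support_right)
    have h1 := G.ncard_edgeSet_isolate_compl_le X₀
    rw [heq] at h1
    refine ⟨?_, by rw [heq]; omega⟩
    by_contra hlt
    push Not at hlt
    have := Nat.mul_le_mul_right X₀.ncard hlt.le
    omega
  have hex : ∃ n, ∃ X, good X ∧ X.ncard = n := ⟨_, X₀, hgood₀, rfl⟩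
  obtain ⟨X, ⟨hX1, hX2⟩, hXn⟩ := Nat.find_spec hex
  have hmin : ∀ Y : Set V, Y.ncard < X.ncard → ¬ good Y := fun Y hY hgY =>
    Nat.find_min hex (hXn ▸ hY) ⟨Y, hgY, rfl⟩
  have hXlt : 2 * k < X.ncard := by
    refine lt_of_le_of_ne hX1 fun heq => ?_
    have h1 := G.ncard_edgeSet_isolate_compl_le X
    rw [← heq] at h1 hX2
    have e1 : 2 * k * (2 * k) = 2 * (2 * k * k) := by ring
    omega
  -- Deleting a vertex of degree at most 2k would leave a smaller good set.
  have hdeg : ∀ v ∈ X, 2 * k < {w | w ∈ X ∧ G.Adj v w}.ncard := by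
    intro v hv
    by_contra hle
    push Not at hle
    have hc := Set.ncard_sdiff_singleton_of_mem hv
    refine hmin (X \ {v}) (by omega) ⟨by omega, ?_⟩
    have h1 := G.ncard_edgeSet_isolate_le_diff_singleton X v
    have h2 : 2 * k * X.ncard = 2 * k * (X \ {v}).ncard + 2 * k := by
      rw [hc, ← Nat.mul_succ, Nat.succ_eq_add_one, Nat.sub_add_cancel (by omega)]
    omega
  have hsupp : (G.isolate Xᶜ).support = X := by
    refine Set.Subset.antisymm (fun v hv => not_not.1 (support_isolate_subset _ _ hv).2) ?_
    intro v hv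
    obtain ⟨w, hw, hadj⟩ := Set.nonempty_of_ncard_ne_zero (s := {w | w ∈ X ∧ G.Adj v w})
      (by have := hdeg v hv; omega)
    exact ⟨w, hadj, not_not.2 hv, not_not.2 hw⟩
  refine ⟨G.isolate Xᶜ, isolate_le _ _, ?_, by rwa [hsupp], ?_⟩
  · intro W hW u hu v hv huW hvW
    rw [hsupp] at hu hv
    by_contra hcon
    let A : Set V := {x | x ∈ X ∧ ConnIn (G.isolate Xᶜ) Wᶜ u x}
    have hstep : ∀ x y, G.Adj x y → x ∈ A → y ∈ X → y ∉ W → y ∈ A := fun x y hxy hx hy hyW =>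
      ⟨hy, hx.2.trans (.of_adj ⟨hxy, not_not.2 hx.1, not_not.2 hy⟩ hx.2.right_mem hyW)⟩
    have huA : u ∈ A := ⟨hu, .refl huW⟩
    have hvA : v ∉ A := fun h => hcon h.2
    -- A is the part of X reachable from u off the separator W. Both sets are smaller than X, and
    -- the degree bound makes each have at least 2k vertices, so neither satisfies the edge bound.
    let X₁ : Set V := A ∪ (W ∩ X)
    let X₂ : Set V := X \ A
    have hX₁ : X₁ ⊂ X := by
      refine Set.ssubset_iff_subset_ne.2 ⟨?_, fun h => ?_⟩
      · rintro x (hx | hx)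
        exacts [hx.1, hx.2]
      · rcases h.symm ▸ hv with h | h
        exacts [hvA h, hvW h.1]
    have hX₂ : X₂ ⊂ X := by
      refine Set.ssubset_iff_subset_ne.2 ⟨Set.sdiff_subset, fun h => ?_⟩
      exact (h.symm ▸ hu : u ∈ X₂).2 huA
    have hbig₁ : 2 * k ≤ X₁.ncard := by
      refine (hdeg u hu).le.trans (Set.ncard_le_ncard ?_)
      rintro w ⟨hw, hadj⟩
      by_cases hwW : w ∈ W
      · exact Or.inr ⟨hwW, hw⟩
      · exact Or.inl (hstep u w hadj huA hw hwW)
    have hbig₂ : 2 * k ≤ X₂.ncard := by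
      refine (hdeg v hv).le.trans (Set.ncard_le_ncard ?_)
      rintro w ⟨hw, hadj⟩
      exact ⟨hw, fun hwA => hvA (hstep w v hadj.symm hwA hv hvW)⟩
    have h1 : ¬ 2 * k * X₁.ncard < _ := fun h => hmin X₁ (Set.ncard_lt_ncard hX₁) ⟨hbig₁, h⟩
    have h2 : ¬ 2 * k * X₂.ncard < _ := fun h => hmin X₂ (Set.ncard_lt_ncard hX₂) ⟨hbig₂, h⟩
    have h3 : (G.isolate Xᶜ).edgeSet.ncard ≤ _ :=
      ncard_edgeSet_isolate_le_union G (X₁ := X₁) (X₂ := X₂) fun x y hxy hx hy => by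
        have aux : ∀ x y, G.Adj x y → y ∈ X → x ∈ A → y ∈ X₁ := fun x y hxy hy hxA => by
          by_cases hyW : y ∈ W
          · exact Or.inr ⟨hyW, hy⟩
          · exact Or.inl (hstep x y hxy hxA hy hyW)
        by_cases hxA : x ∈ A
        · exact Or.inl ⟨Or.inl hxA, aux x y hxy hy hxA⟩
        by_cases hyA : y ∈ A
        · exact Or.inl ⟨aux y x hxy.symm hx hyA, Or.inl hyA⟩
        · exact Or.inr ⟨⟨hx, hxA⟩, hy, hyA⟩
    -- The two sets share only vertices of W, fewer than k. Adding their edge bounds gives e(G[X]) ≤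
    -- 2k(|X| - k - 1), a contradiction.
    have h4 : X₁.ncard + X₂.ncard + 1 ≤ X.ncard + k := by
      have e1 : X₁.ncard ≤ A.ncard + W.ncard := (Set.ncard_union_le _ _).trans
        (Nat.add_le_add_left (Set.ncard_le_ncard Set.inter_subset_left) _)
      have e2 := Set.ncard_sdiff_add_ncard_of_subset (s := A) (t := X) fun x hx => hx.1
      change X₂.ncard + _ = _ at e2
      omega
    have h5 := Nat.mul_le_mul_left (2 * k) h4
    rw [mul_add, mul_add, mul_add] at h5
    omega
  · rw [hsupp]
    have := Nat.mul_le_mul_left k hX1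
    have e1 : k * (2 * k) = 2 * k * k := by ring
    have e2 : 2 * k * X.ncard = k * X.ncard + k * X.ncard := by ring
    omega

/-! ### Pieces and their merging -/

/-- A compatible system of scales: `k` is the connectivity of the building blocks, `s m` the
connectivity of a piece of level `m`, `q` the length gained at each step and `T` the number of
steps after which a path of length `d` appears. -/
structure Scales (d k b g q T : ℕ) (s : ℕ → ℕ) : Prop where
  zero : s 0 = b
  step : ∀ m, (T + 2) * s (m + 1) ≤ s m
  large : ∀ m ≤ T, d / g + 1 < s m
  one_le_g : 1 ≤ g
  g_lt : g < b
  b_le : 4 * b ≤ k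
  q_le : 2 * (q + g) ≤ k
  lt_T : d < T * q

namespace Scales

variable {d k b g q T : ℕ} {s : ℕ → ℕ}

theorem antitone (h : Scales d k b g q T s) : Antitone s :=
  antitone_nat_of_succ_le fun m => by
    have := h.step m
    nlinarith [Nat.zero_le (s (m + 1)), Nat.zero_le (T * s (m + 1))]

theorem le_b (h : Scales d k b g q T s) (m : ℕ) : s m ≤ b := h.zero ▸ h.antitone (Nat.zero_le m)

end Scales

/-- A piece of level `m`: it is `s m`-connected, has a path with at least `k + m * q` vertices,
contains a `k`-connected subgraph and has average degree at least `2 * k`. -/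
structure IsPiece (k q : ℕ) (s : ℕ → ℕ) (m : ℕ) (H : SimpleGraph V) : Prop where
  conn : SConn (s m) H
  path : ∃ (u v : V) (p : H.Walk u v), p.IsPath ∧ k + m * q ≤ p.length + 1
  core : ∃ R ≤ H, SConn k R ∧ 2 * k < R.support.ncard
  dense : k * H.support.ncard ≤ H.edgeSet.ncard

/-- All paths of `G` have fewer than `d` edges. -/
def PathsLT (d : ℕ) (G : SimpleGraph V) : Prop :=
  ∀ (u v : V) (p : G.Walk u v), p.IsPath → p.length < d

theorem PathsLT.mono {d : ℕ} {G H : SimpleGraph V} (h : PathsLT d G) (hHG : H ≤ G) :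
    PathsLT d H := fun u v p hp => by
  simpa using h u v (p.mapLe hHG) ((Walk.isPath_mapLe hHG).2 hp)

theorem support_sup_eq (H H' : SimpleGraph V) : (H ⊔ H').support = H.support ∪ H'.support := by
  ext v
  simp only [mem_support, sup_adj, exists_or, Set.mem_union]

variable {d k b g q T : ℕ} {s : ℕ → ℕ} {G H H' : SimpleGraph V} {m m' : ℕ}

theorem IsPiece.lt_T (hs : Scales d k b g q T s) (h : IsPiece k q s m H) (hP : PathsLT d H) :
    m < T := by
  obtain ⟨u, v, p, hp, hlen⟩ := h.path
  have h1 := hP u v p hp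
  by_contra hle
  push Not at hle
  have := Nat.mul_le_mul_right q hle
  have := hs.lt_T
  omega

variable [Finite V]

theorem IsPiece.support_large (h : IsPiece k q s m H) : 2 * k < H.support.ncard := by
  obtain ⟨R, hRH, -, hR⟩ := h.core
  exact hR.trans_le (Set.ncard_le_ncard (support_mono hRH))

theorem isPiece_zero (hs : Scales d k b g q T s) (hH : SConn k H) (hcard : 2 * k < H.support.ncard)
    (hdense : k * H.support.ncard ≤ H.edgeSet.ncard) : IsPiece k q s 0 H where
  conn := hH.mono (by have := hs.zero; have := hs.b_le; omega)
  core := ⟨H, le_rfl, hH, hcard⟩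
  dense := hdense
  path := by
    have := hs.b_le
    have := hs.g_lt
    have h1 : 1 < H.support.ncard := by omega
    obtain ⟨x, y, hx, hy, hxy⟩ := (Set.one_lt_ncard_iff).1 h1
    obtain ⟨p, hp, hlen⟩ := hH.exists_long_path (by omega) (by omega) hx hy hxy
    exact ⟨x, y, p, hp, by omega⟩

theorem dense_sup (hd : Disjoint H H') (h : k * H.support.ncard ≤ H.edgeSet.ncard)
    (h' : k * H'.support.ncard ≤ H'.edgeSet.ncard) :
    k * (H ⊔ H').support.ncard ≤ (H ⊔ H').edgeSet.ncard := by
  rw [support_sup_eq, edgeSet_sup, Set.ncard_union_eq (disjoint_edgeSet.2 hd)]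
  calc _ ≤ k * (H.support.ncard + H'.support.ncard) :=
        Nat.mul_le_mul_left _ (Set.ncard_union_le _ _)
    _ ≤ _ := by rw [mul_add]; omega

/-- The overlap is so large that the union keeps the connectivity of the higher-level piece. -/
theorem IsPiece.sup_of_le (hs : Scales d k b g q T s) (h : IsPiece k q s m H)
    (h' : IsPiece k q s m' H') (hm : m' ≤ m) (hd : Disjoint H H')
    (hcap : s m ≤ (H.support ∩ H'.support).ncard) : IsPiece k q s m (H ⊔ H') where
  conn := h.conn.sup (h'.conn.mono (hs.antitone hm)) hcap
  path := by
    obtain ⟨u, v, p, hp, hlen⟩ := h.path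
    exact ⟨u, v, p.mapLe le_sup_left, (Walk.isPath_mapLe _).2 hp, by simpa using hlen⟩
  core := by
    obtain ⟨R, hRH, hR⟩ := h.core
    exact ⟨R, hRH.trans le_sup_left, hR⟩
  dense := dense_sup hd h.dense h'.dense

/-- A medium overlap costs one level of connectivity but pays with a longer path. The path of H
meets the core R of H' in fewer than b vertices; what is left of R is k/2-connected and off the
path, so a detour gains at least k/2 - g ≥ q. -/
theorem IsPiece.sup_of_lt (hs : Scales d k b g q T s) (h : IsPiece k q s m H)
    (h' : IsPiece k q s m' H') (hm : m' ≤ m) (hd : Disjoint H H') (hP : PathsLT d (H ⊔ H'))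
    (hcap : s (m + 1) ≤ (H.support ∩ H'.support).ncard)
    (hcap' : (H.support ∩ H'.support).ncard < s m) : IsPiece k q s (m + 1) (H ⊔ H') := by
  have hmT := h.lt_T hs (hP.mono le_sup_left)
  have hconn : SConn (s (m + 1)) (H ⊔ H') :=
    (h.conn.mono (hs.antitone (Nat.le_succ m))).sup
      (h'.conn.mono (hs.antitone (hm.trans (Nat.le_succ m)))) hcap
  refine ⟨hconn, ?_, ?_, dense_sup hd h.dense h'.dense⟩
  · obtain ⟨u, v, p, hp, hlen⟩ := h.path
    obtain ⟨R, hRH, hR, hRcard⟩ := h'.core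
    have hb := hs.b_le
    have hg := hs.g_lt
    have hq := hs.q_le
    have hsb := hs.le_b m
    have hsb' := hs.le_b (m + 1)
    have huv : u ≠ v := by
      rintro rfl
      have := Walk.length_eq_zero_iff.2 (Walk.isPath_iff_nil.1 hp)
      omega
    let U : Set V := {x | x ∈ p.support}
    have hU : (U ∩ R.support).ncard < b := by
      refine lt_of_le_of_lt (Set.ncard_le_ncard ?_) (hcap'.trans_le hsb)
      rintro x ⟨hx, hxR⟩
      exact ⟨p.mem_support_graph_of_ne huv hx, support_mono hRH hxR⟩
    have hRU : SConn (k / 2) (R.isolate U) := hR.isolate (by omega)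
    have hRUcard := hR.ncard_support_isolate (U := U) (by omega) (by omega)
    let p' : (H ⊔ H').Walk u v := p.mapLe le_sup_left
    have hp' : p'.IsPath := (Walk.isPath_mapLe _).2 hp
    have hlen' : p'.length = p.length := by simp [p']
    have hpd := hP u v p' hp'
    have hlarge := hs.large (m + 1) hmT
    have hdiv : p'.length / g ≤ d / g := Nat.div_le_div_right hpd.le
    have hdis : ∀ x ∈ p'.support, x ∉ (R.isolate U).support := by
      intro x hx hxR
      exact (support_isolate_subset _ _ hxR).2 (by simpa [p', U] using hx)
    obtain ⟨u', w', Q, hQ, hQlen⟩ := hconn.exists_longer_path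
      ((isolate_le _ _).trans (hRH.trans le_sup_right)) hRU (by omega) (by omega) hp' hdis
      hs.one_le_g (by omega) (by omega) (by omega)
    refine ⟨u', w', Q, hQ, ?_⟩
    have : (m + 1) * q = m * q + q := by ring
    omega
  · obtain ⟨R, hRH, hR⟩ := h.core
    exact ⟨R, hRH.trans le_sup_left, hR⟩

/-- A longest path of a piece covers almost all of its edges. -/
theorem IsPiece.exists_cover (hs : Scales d k b g q T s) (h : IsPiece k q s m H)
    (hP : PathsLT d H) : ∃ P : Set V, P.ncard ≤ d ∧
      (H.isolate P).edgeSet.ncard ≤ 2 * b * H.support.ncard := by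
  classical
  let good : ℕ → Prop := fun n => ∃ (u v : V) (p : H.Walk u v), p.IsPath ∧ p.length = n
  obtain ⟨u₀, v₀, p₀, hp₀, hlen₀⟩ := h.path
  have hgood₀ : good p₀.length := ⟨u₀, v₀, p₀, hp₀, rfl⟩
  have h0 := (hP _ _ p₀ hp₀).le
  obtain ⟨u, v, p, hp, hplen⟩ := Nat.findGreatest_spec (P := good) h0 hgood₀
  have hmax : ∀ (u' v' : V) (p' : H.Walk u' v'), p'.IsPath → p'.length ≤ p.length := by
    intro u' v' p' hp'
    rw [hplen]
    exact Nat.le_findGreatest (hP _ _ p' hp').le ⟨u', v', p', hp', rfl⟩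
  have hpd := hP _ _ p hp
  refine ⟨{x | x ∈ p.support}, by rw [hp.ncard_support]; omega, ?_⟩
  by_contra hlt
  push Not at hlt
  -- Too many edges missing the path would contain a b-connected subgraph; the detour through it
  -- gains at least b - g > 0 edges.
  obtain ⟨R, hRH, hR, hRcard, -⟩ := exists_sConn_subgraph _
    ((support_isolate_subset H _).trans Set.sdiff_subset) hlt
  have hb := hs.b_le
  have hg := hs.g_lt
  have hsb := hs.le_b m
  have hlarge := hs.large m (h.lt_T hs hP).le
  have hdiv : p.length / g ≤ d / g := Nat.div_le_div_right hpd.le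
  have hmax₀ := hmax _ _ p₀ hp₀
  obtain ⟨u', w', Q, hQ, hQlen⟩ := h.conn.exists_longer_path (hRH.trans (isolate_le _ _)) hR
    (by omega) (by omega) hp (fun x hx hxR => (support_isolate_subset _ _
      (support_mono hRH hxR)).2 hx) hs.one_le_g (by omega) (by omega) (by omega)
  have := hmax _ _ Q hQ
  omega

/-! ### Families of pieces with small overlaps -/

/-- The edges of `G`, up to few, split into edge-disjoint pieces of level `0`. -/
theorem exists_isPiece_family (hs : Scales d k b g q T s) (G : SimpleGraph V) :
    ∃ F : Finset (SimpleGraph V), (∀ H ∈ F, H ≤ G ∧ ∃ m, IsPiece k q s m H) ∧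
      (∀ H ∈ F, ∀ H' ∈ F, H ≠ H' → Disjoint H H') ∧
      (G.edgeSet \ ⋃ H ∈ F, H.edgeSet).ncard ≤ 2 * k * Nat.card V := by
  classical
  induction G using WellFoundedLT.induction with
  | _ G ih =>
    by_cases hG : G.edgeSet.ncard ≤ 2 * k * Nat.card V
    · exact ⟨∅, by simp, by simp, by simpa using hG⟩
    push Not at hG
    rw [← Set.ncard_univ] at hG
    obtain ⟨R, hRG, hR, hRcard, hRdense⟩ := exists_sConn_subgraph G (Set.subset_univ _) hG
    have hlt : G \ R < G := by
      refine lt_of_le_of_ne sdiff_le fun heq => ?_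
      obtain ⟨v, w, hvw⟩ := Set.nonempty_of_ncard_ne_zero (s := R.support) (by omega)
      have h1 : (G \ R).Adj v w := heq.symm ▸ hRG hvw
      exact h1.2 hvw
    obtain ⟨F, hF1, hF2, hF3⟩ := ih _ hlt
    have hdis : ∀ H ∈ F, Disjoint R H := fun H hH =>
      (disjoint_sdiff_self_right).mono_right (hF1 H hH).1
    refine ⟨insert R F, ?_, ?_, ?_⟩
    · intro H hH
      rcases Finset.mem_insert.1 hH with rfl | hH
      · exact ⟨hRG, 0, isPiece_zero hs hR hRcard hRdense⟩
      · exact ⟨(hF1 H hH).1.trans sdiff_le, (hF1 H hH).2⟩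
    · intro H hH H' hH' hne
      rcases Finset.mem_insert.1 hH with h | h <;> rcases Finset.mem_insert.1 hH' with h' | h'
      · exact absurd (h.trans h'.symm) hne
      · exact h ▸ hdis _ h'
      · exact h' ▸ (hdis _ h).symm
      · exact hF2 H h H' h' hne
    · refine le_trans (Set.ncard_le_ncard ?_) hF3
      rintro e ⟨he, he'⟩
      simp only [Finset.mem_insert, Set.iUnion_iUnion_eq_or_left, Set.mem_union, not_or] at he'
      exact ⟨by rw [edgeSet_sdiff]; exact ⟨he, he'.1⟩, he'.2⟩

/-- The pieces can be merged until any two of them share few vertices. -/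
theorem exists_isPiece_family_separated (hs : Scales d k b g q T s) (hP : PathsLT d G) :
    ∃ (F : Finset (SimpleGraph V)) (lev : SimpleGraph V → ℕ),
      (∀ H ∈ F, H ≤ G ∧ IsPiece k q s (lev H) H) ∧
      (∀ H ∈ F, ∀ H' ∈ F, H ≠ H' → Disjoint H H') ∧
      (G.edgeSet \ ⋃ H ∈ F, H.edgeSet).ncard ≤ 2 * k * Nat.card V ∧
      ∀ H ∈ F, ∀ H' ∈ F, H ≠ H' → (H.support ∩ H'.support).ncard < s (lev H + 1) := by
  classical
  let good : Finset (SimpleGraph V) → Prop := fun F =>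
    (∀ H ∈ F, H ≤ G ∧ ∃ m, IsPiece k q s m H) ∧
      (∀ H ∈ F, ∀ H' ∈ F, H ≠ H' → Disjoint H H') ∧
      (G.edgeSet \ ⋃ H ∈ F, H.edgeSet).ncard ≤ 2 * k * Nat.card V
  have hex : ∃ n, ∃ F, good F ∧ F.card = n := by
    obtain ⟨F, hF⟩ := exists_isPiece_family hs G
    exact ⟨_, F, hF, rfl⟩
  obtain ⟨F, ⟨hF1, hF2, hF3⟩, hFn⟩ := Nat.find_spec hex
  -- With the fewest pieces possible, no two of them have a union that is again a piece.
  have hmin : ∀ F' : Finset (SimpleGraph V), good F' → F.card ≤ F'.card := fun F' hF' =>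
    hFn ▸ Nat.find_min' hex ⟨F', hF', rfl⟩
  have hmerge : ∀ H ∈ F, ∀ H' ∈ F, H ≠ H' → ¬ ∃ m, IsPiece k q s m (H ⊔ H') := by
    rintro H hH H' hH' hne hpiece
    have hdis : ∀ K ∈ (F.erase H).erase H', Disjoint (H ⊔ H') K := by
      intro K hK
      rw [Finset.mem_erase, Finset.mem_erase] at hK
      exact disjoint_sup_left.2 ⟨hF2 H hH K hK.2.2 hK.2.1.symm, hF2 H' hH' K hK.2.2 hK.1.symm⟩
    have hle := hmin (insert (H ⊔ H') ((F.erase H).erase H')) ⟨?_, ?_, ?_⟩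
    · have h1 := Finset.card_insert_le (H ⊔ H') ((F.erase H).erase H')
      have h2 := Finset.card_erase_lt_of_mem hH
      have h3 := Finset.card_erase_lt_of_mem (Finset.mem_erase.2 ⟨hne.symm, hH'⟩)
      omega
    · intro K hK
      rcases Finset.mem_insert.1 hK with rfl | hK
      · exact ⟨sup_le (hF1 H hH).1 (hF1 H' hH').1, hpiece⟩
      · exact hF1 K (Finset.mem_of_mem_erase (Finset.mem_of_mem_erase hK))
    · intro K hK K' hK' hKK'
      rcases Finset.mem_insert.1 hK with rfl | hK <;> rcases Finset.mem_insert.1 hK' with rfl | hK'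
      · exact absurd rfl hKK'
      · exact hdis _ hK'
      · exact (hdis _ hK).symm
      · exact hF2 K (Finset.mem_of_mem_erase (Finset.mem_of_mem_erase hK)) K'
          (Finset.mem_of_mem_erase (Finset.mem_of_mem_erase hK')) hKK'
    · refine le_trans (Set.ncard_le_ncard (Set.sdiff_subset_sdiff_right ?_)) hF3
      refine Set.iUnion₂_subset fun K hK e he => ?_
      rw [Set.mem_iUnion₂]
      by_cases hKH : K = H
      · exact ⟨H ⊔ H', Finset.mem_insert_self _ _, edgeSet_mono le_sup_left (hKH ▸ he)⟩
      by_cases hKH' : K = H'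
      · exact ⟨H ⊔ H', Finset.mem_insert_self _ _, edgeSet_mono le_sup_right (hKH' ▸ he)⟩
      · exact ⟨K, Finset.mem_insert_of_mem
          (Finset.mem_erase.2 ⟨hKH', Finset.mem_erase.2 ⟨hKH, hK⟩⟩), he⟩
  have hlev : ∀ H, ∃ m, H ∈ F → IsPiece k q s m H := fun H => by
    by_cases hH : H ∈ F
    · obtain ⟨m, hm⟩ := (hF1 H hH).2
      exact ⟨m, fun _ => hm⟩
    · exact ⟨0, fun h => absurd h hH⟩
  choose lev hlev using hlev
  have key : ∀ H ∈ F, ∀ H' ∈ F, H ≠ H' → lev H' ≤ lev H →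
      (H.support ∩ H'.support).ncard < s (lev H + 1) := by
    intro H hH H' hH' hne hle
    by_contra hcap
    push Not at hcap
    refine hmerge H hH H' hH' hne ?_
    by_cases hbig : s (lev H) ≤ (H.support ∩ H'.support).ncard
    · exact ⟨_, (hlev H hH).sup_of_le hs (hlev H' hH') hle (hF2 H hH H' hH' hne) hbig⟩
    · exact ⟨_, (hlev H hH).sup_of_lt hs (hlev H' hH') hle (hF2 H hH H' hH' hne)
        (hP.mono (sup_le (hF1 H hH).1 (hF1 H' hH').1)) hcap (not_le.1 hbig)⟩
  refine ⟨F, lev, fun H hH => ⟨(hF1 H hH).1, hlev H hH⟩, hF2, hF3, fun H hH H' hH' hne => ?_⟩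
  rcases le_total (lev H') (lev H) with hle | hle
  · exact key H hH H' hH' hne hle
  · rw [Set.inter_comm]
    exact (key H' hH' H hH hne.symm hle).trans_le (hs.antitone (Nat.succ_le_succ hle))

/-! ### Making the pieces vertex-disjoint -/

/-- In a separated family of pieces some piece shares few vertices with the others: otherwise a
path could wander through many pieces. -/
theorem exists_few_shared (hs : Scales d k b g q T s) (hP : PathsLT d G)
    {F : Finset (SimpleGraph V)} {lev : SimpleGraph V → ℕ}
    (hF : ∀ H ∈ F, H ≤ G ∧ IsPiece k q s (lev H) H)
    (hsep : ∀ H ∈ F, ∀ H' ∈ F, H ≠ H' → (H.support ∩ H'.support).ncard < s (lev H + 1))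
    (hne : F.Nonempty) :
    ∃ H ∈ F, {v | v ∈ H.support ∧ ∃ H' ∈ F, H' ≠ H ∧ v ∈ H'.support}.ncard ≤ b := by
  classical
  by_contra hcon
  push Not at hcon
  have hb := hs.b_le
  have hg := hs.g_lt
  have hg1 := hs.one_le_g
  have hq := hs.q_le
  -- E is the set of pieces already traversed and Q the next one; the path has only its end p
  -- possibly outside the pieces of E.
  have claim : ∀ j ≤ T, ∃ E ⊆ F, E.card = j ∧ ∃ Q ∈ F, Q ∉ E ∧ ∃ x, ∃ p ∈ Q.support,
      ∃ w : G.Walk x p, w.IsPath ∧ j * q ≤ w.length ∧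
        ∀ y ∈ w.support, y = p ∨ ∃ H ∈ E, y ∈ H.support := by
    intro j
    induction j with
    | zero =>
      intro _
      obtain ⟨Q, hQ⟩ := hne
      have := (hF Q hQ).2.support_large
      obtain ⟨p, hp⟩ := Set.nonempty_of_ncard_ne_zero (s := Q.support) (by omega)
      exact ⟨∅, by simp, rfl, Q, hQ, by simp, p, p, hp, .nil, by simp, by simp, by simp⟩
    | succ j ih =>
      intro hj
      obtain ⟨E, hEF, hEcard, Q, hQ, hQE, x, p, hp, w, hw, hwlen, hwE⟩ := ih (by omega)
      obtain ⟨hQG, hQp⟩ := hF Q hQ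
      set m := lev Q with hm
      have hstep := hs.step m
      -- The factor T + 2 in `Scales.step` is spent here: Q loses at most T * s (m + 1) vertices to
      -- visited pieces and stays 2-connected.
      have hTm : T * s (m + 1) + 2 ≤ s m := by
        have hmT := hQp.lt_T hs (hP.mono hQG)
        have h1 : 1 < s (m + 1) := (Nat.le_add_left 1 _).trans_lt (hs.large (m + 1) hmT)
        have h2 : (T + 2) * s (m + 1) = T * s (m + 1) + 2 * s (m + 1) := by ring
        omega
      have hsb := hs.le_b m
      let C : Set V := ⋃ H ∈ E, Q.support ∩ H.support
      have hC : C.ncard ≤ T * s (m + 1) := by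
        calc C.ncard ≤ ∑ H ∈ E, (Q.support ∩ H.support).ncard := Finset.set_ncard_biUnion_le _ _
          _ ≤ ∑ H ∈ E, s (m + 1) := Finset.sum_le_sum fun H hH =>
              (hsep Q hQ H (hEF hH) (fun e => hQE (e ▸ hH))).le
          _ ≤ T * s (m + 1) := by
              rw [Finset.sum_const, smul_eq_mul]
              exact Nat.mul_le_mul_right _ (by omega)
      have hlt : (insert p C).ncard <
          {v | v ∈ Q.support ∧ ∃ H' ∈ F, H' ≠ Q ∧ v ∈ H'.support}.ncard :=
        (Set.ncard_insert_le _ _).trans_lt (lt_of_le_of_lt (by omega) (hcon Q hQ))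
      -- The exit p' lies outside every visited piece, so the piece Q' it leads to is new.
      obtain ⟨p', ⟨hp', Q', hQ', hQQ', hp'Q'⟩, hp'C⟩ := Set.exists_mem_notMem_of_ncard_lt_ncard hlt
      rw [Set.mem_insert_iff, not_or] at hp'C
      have hCmem : ∀ y ∈ Q.support, (∃ H ∈ E, y ∈ H.support) → y ∈ C := by
        rintro y hy ⟨H, hH, hyH⟩
        exact Set.mem_iUnion₂.2 ⟨H, hH, hy, hyH⟩
      let U : Set V := {y | y ∈ w.support ∧ y ≠ p}
      have hUE : ∀ y ∈ U, ∃ H ∈ E, y ∈ H.support := fun y hy => (hwE y hy.1).resolve_left hy.2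
      have hUC : U ∩ Q.support ⊆ C := fun y hy => hCmem y hy.2 (hUE y hy.1)
      have hUcard : (U ∩ Q.support).ncard ≤ T * s (m + 1) := (Set.ncard_le_ncard hUC).trans hC
      have hlarge := hQp.support_large
      obtain ⟨R, hRQ, hR, hRcard⟩ := hQp.core
      have hURcard : (U ∩ R.support).ncard ≤ T * s (m + 1) :=
        (Set.ncard_le_ncard (Set.inter_subset_inter_right _ (support_mono hRQ))).trans hUcard
      have hsupp := hQp.conn.support_isolate (U := U) (by omega) (by omega)
      have hRU : SConn (k / 2) (R.isolate U) := hR.isolate (by omega)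
      have hRUcard := hR.ncard_support_isolate (U := U) (by omega) (by omega)
      have hpU : p ∈ (Q.isolate U).support := hsupp ▸ ⟨hp, fun h => h.2 rfl⟩
      have hp'U : p' ∈ (Q.isolate U).support :=
        hsupp ▸ ⟨hp', fun h => hp'C.2 (hCmem p' hp' (hUE p' h))⟩
      -- Inside Q, off the earlier path, one travels from p to p' through the remaining core, using
      -- at least k/2 - 1 ≥ q edges.
      obtain ⟨r, hr, hrlen⟩ := (hQp.conn.isolate (t := 2) (U := U) (by omega)).exists_path_through
        (isolate_mono hRQ U) hRU (by omega) (by omega) hpU hp'U (Ne.symm hp'C.1)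
      have hrs : ∀ y ∈ r.support, y ∈ Q.support ∧ y ∉ U := fun y hy =>
        support_isolate_subset _ _ (r.mem_support_graph_of_ne (Ne.symm hp'C.1) hy)
      let r' : G.Walk p p' := r.mapLe ((isolate_le _ _).trans hQG)
      have hr' : r'.IsPath := (Walk.isPath_mapLe _).2 hr
      have hr's : ∀ y, y ∈ r'.support ↔ y ∈ r.support := fun y => by simp [r']
      have hr'len : r'.length = r.length := by simp [r']
      refine ⟨insert Q E, ?_, ?_, Q', hQ', ?_, x, p', hp'Q', w.append r', ?_, ?_, ?_⟩
      · exact Finset.insert_subset hQ hEF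
      · rw [Finset.card_insert_of_notMem hQE, hEcard]
      · intro hmem
        rcases Finset.mem_insert.1 hmem with h | h
        · exact hQQ' h
        · exact hp'C.2 (hCmem p' hp' ⟨Q', h, hp'Q'⟩)
      · refine hw.append_of_inter hr' fun y hy hy' => ?_
        by_contra hyp
        exact (hrs y ((hr's y).1 hy')).2 ⟨hy, hyp⟩
      · rw [Walk.length_append]
        have : (j + 1) * q = j * q + q := by ring
        omega
      · intro y hy
        right
        rcases (Walk.mem_support_append_iff _ _).1 hy with h | h
        · rcases hwE y h with rfl | ⟨H, hH, hyH⟩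
          · exact ⟨Q, Finset.mem_insert_self _ _, hp⟩
          · exact ⟨H, Finset.mem_insert_of_mem hH, hyH⟩
        · exact ⟨Q, Finset.mem_insert_self _ _, (hrs y ((hr's y).1 h)).1⟩
  obtain ⟨E, -, -, Q, -, -, x, p, -, w, hw, hlen, -⟩ := claim T le_rfl
  have := hP x p w hw
  have := hs.lt_T
  omega

/-- Removing few vertices from each piece makes the pieces vertex-disjoint. -/
theorem exists_separating_sets (hs : Scales d k b g q T s) (hP : PathsLT d G)
    {lev : SimpleGraph V → ℕ} (F : Finset (SimpleGraph V))
    (hF : ∀ H ∈ F, H ≤ G ∧ IsPiece k q s (lev H) H)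
    (hsep : ∀ H ∈ F, ∀ H' ∈ F, H ≠ H' → (H.support ∩ H'.support).ncard < s (lev H + 1)) :
    ∃ Y : SimpleGraph V → Set V, (∀ H ∈ F, (Y H).ncard ≤ b) ∧
      ∀ H ∈ F, ∀ H' ∈ F, H ≠ H' → Disjoint (H.support \ Y H) (H'.support \ Y H') := by
  classical
  induction F using Finset.strongInduction with
  | _ F ih =>
    rcases F.eq_empty_or_nonempty with rfl | hne
    · exact ⟨fun _ => ∅, by simp, by simp⟩
    obtain ⟨H, hH, hHb⟩ := exists_few_shared hs hP hF hsep hne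
    obtain ⟨Y, hY1, hY2⟩ := ih (F.erase H) (Finset.erase_ssubset hH)
      (fun K hK => hF K (Finset.mem_of_mem_erase hK))
      (fun K hK K' hK' => hsep K (Finset.mem_of_mem_erase hK) K' (Finset.mem_of_mem_erase hK'))
    -- Z alone separates H from all remaining pieces, so each pair is handled by whichever piece is
    -- removed first.
    let Z : Set V := {v | v ∈ H.support ∧ ∃ H' ∈ F, H' ≠ H ∧ v ∈ H'.support}
    have hZ : ∀ K ∈ F, K ≠ H → Disjoint (H.support \ Z) (K.support \ Y K) := by
      intro K hK hne
      rw [Set.disjoint_left]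
      rintro v ⟨hv, hvZ⟩ ⟨hvK, -⟩
      exact hvZ ⟨hv, K, hK, hne, hvK⟩
    refine ⟨Function.update Y H Z, fun K hK => ?_, fun K hK K' hK' hne => ?_⟩
    · by_cases hKH : K = H
      · rw [hKH, Function.update_self]
        exact hHb
      · rw [Function.update_of_ne hKH]
        exact hY1 K (Finset.mem_erase.2 ⟨hKH, hK⟩)
    · by_cases hKH : K = H
      · subst hKH
        rw [Function.update_self, Function.update_of_ne hne.symm]
        exact hZ K' hK' hne.symm
      · by_cases hKH' : K' = H
        · subst hKH'
          rw [Function.update_self, Function.update_of_ne hne]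
          exact (hZ K hK hne).symm
        · rw [Function.update_of_ne hKH, Function.update_of_ne hKH']
          exact hY2 K (Finset.mem_erase.2 ⟨hKH, hK⟩) K' (Finset.mem_erase.2 ⟨hKH', hK'⟩) hne

/-! ### Deleting edges and covering components -/

theorem ncard_edges_meeting_le (H : SimpleGraph V) (Y : Set V) :
    {e | e ∈ H.edgeSet ∧ ∃ v ∈ Y, v ∈ e}.ncard ≤ Y.ncard * H.support.ncard := by
  rw [← Set.ncard_prod]
  refine (Set.ncard_le_ncard ?_).trans
    (Set.ncard_image_le (f := fun z : V × V => s(z.1, z.2)) (Set.toFinite _))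
  rintro e ⟨he, v, hv, hve⟩
  obtain ⟨w, rfl⟩ := hve
  exact ⟨(v, w), ⟨hv, (show H.Adj v w from he).mem_support_right⟩, rfl⟩

/-- A graph without paths of length `d` becomes, after deleting few edges, a graph whose connected
components have small vertex covers. -/
theorem exists_deletion_cover (hs : Scales d k b g q T s) (hP : PathsLT d G) :
    ∃ D ⊆ G.edgeSet, k * D.ncard ≤ 2 * k * k * Nat.card V + 3 * b * G.edgeSet.ncard ∧
      ∀ K : (G.deleteEdges D).ConnectedComponent, ∃ S : Set V, S.ncard ≤ d ∧
        ∀ x y, (G.deleteEdges D).Adj x y → x ∈ K.supp → x ∈ S ∨ y ∈ S := by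
  classical
  have := Fintype.ofFinite V
  obtain ⟨F, lev, hF, hdis, hleft, hsep⟩ := exists_isPiece_family_separated hs hP
  obtain ⟨Y, hY, hYdis⟩ := exists_separating_sets hs hP F hF hsep
  have hcov : ∀ H, ∃ P : Set V, H ∈ F → P.ncard ≤ d ∧
      (H.isolate P).edgeSet.ncard ≤ 2 * b * H.support.ncard := fun H => by
    by_cases hH : H ∈ F
    · obtain ⟨P, hP⟩ := (hF H hH).2.exists_cover hs (hP.mono (hF H hH).1)
      exact ⟨P, fun _ => hP⟩
    · exact ⟨∅, fun h => absurd h hH⟩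
  choose P hcov using hcov
  -- At most 2b|H| edges are missed by the covering path and at most b|H| meet `Y H`; hence the
  -- factor 3b.
  let bad : SimpleGraph V → Set (Sym2 V) := fun H =>
    (H.isolate (P H)).edgeSet ∪ {e | e ∈ H.edgeSet ∧ ∃ v ∈ Y H, v ∈ e}
  let D : Set (Sym2 V) := (G.edgeSet \ ⋃ H ∈ F, H.edgeSet) ∪ ⋃ H ∈ F, bad H
  have hbad : ∀ H ∈ F, (bad H).ncard ≤ 3 * b * H.support.ncard := by
    intro H hH
    have h1 := Set.ncard_union_le (H.isolate (P H)).edgeSet {e | e ∈ H.edgeSet ∧ ∃ v ∈ Y H, v ∈ e}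
    have h2 := (hcov H hH).2
    have h3 := (ncard_edges_meeting_le H (Y H)).trans (Nat.mul_le_mul_right _ (hY H hH))
    have h4 : 3 * b * H.support.ncard = 2 * b * H.support.ncard + b * H.support.ncard := by ring
    exact h1.trans (by omega)
  have hsum : ∑ H ∈ F, k * H.support.ncard ≤ G.edgeSet.ncard := by
    calc ∑ H ∈ F, k * H.support.ncard ≤ ∑ H ∈ F, H.edgeSet.ncard :=
          Finset.sum_le_sum fun H hH => (hF H hH).2.dense
      _ = ∑ H ∈ F, H.edgeSet.toFinset.card :=
          Finset.sum_congr rfl fun H _ => Set.ncard_eq_toFinset_card' _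
      _ = (F.biUnion fun H => H.edgeSet.toFinset).card := by
          refine (Finset.card_biUnion fun H hH H' hH' hne => ?_).symm
          exact Set.disjoint_toFinset.2 (disjoint_edgeSet.2 (hdis H hH H' hH' hne))
      _ ≤ G.edgeSet.toFinset.card := by
          refine Finset.card_le_card (Finset.biUnion_subset.2 fun H hH => ?_)
          rw [Set.toFinset_subset_toFinset]
          exact edgeSet_mono (hF H hH).1
      _ = G.edgeSet.ncard := (Set.ncard_eq_toFinset_card' _).symm
  have hkeep : ∀ x y, (G.deleteEdges D).Adj x y → ∃ H ∈ F, x ∈ H.support \ Y H ∧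
      y ∈ H.support \ Y H ∧ (x ∈ P H ∨ y ∈ P H) := by
    intro x y hxy
    rw [deleteEdges_adj] at hxy
    obtain ⟨hxy, hD⟩ := hxy
    have hex : s(x, y) ∈ ⋃ H ∈ F, H.edgeSet := by
      by_contra h
      exact hD (Or.inl ⟨hxy, h⟩)
    obtain ⟨H, hH, hHxy⟩ := Set.mem_iUnion₂.1 hex
    have hHxy' : H.Adj x y := hHxy
    have hb : s(x, y) ∉ bad H := fun h => hD (Or.inr (Set.mem_iUnion₂.2 ⟨H, hH, h⟩))
    refine ⟨H, hH, ⟨hHxy'.mem_support_left, fun h => ?_⟩, ⟨hHxy'.mem_support_right, fun h => ?_⟩, ?_⟩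
    · exact hb (Or.inr ⟨hHxy, x, h, Sym2.mem_mk_left x y⟩)
    · exact hb (Or.inr ⟨hHxy, y, h, Sym2.mem_mk_right x y⟩)
    · by_contra h
      rw [not_or] at h
      exact hb (Or.inl ⟨hHxy', h.1, h.2⟩)
  refine ⟨D, ?_, ?_, ?_⟩
  · rintro e (he | he)
    · exact he.1
    · obtain ⟨H, hH, he⟩ := Set.mem_iUnion₂.1 he
      refine edgeSet_mono (hF H hH).1 ?_
      rcases he with he | he
      · exact edgeSet_mono (isolate_le _ _) he
      · exact he.1
  · have h1 : D.ncard ≤ 2 * k * Nat.card V + ∑ H ∈ F, 3 * b * H.support.ncard :=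
      (Set.ncard_union_le _ _).trans (add_le_add hleft
        ((Finset.set_ncard_biUnion_le _ _).trans (Finset.sum_le_sum hbad)))
    calc k * D.ncard ≤ k * (2 * k * Nat.card V + ∑ H ∈ F, 3 * b * H.support.ncard) :=
          Nat.mul_le_mul_left _ h1
      _ = 2 * k * k * Nat.card V + 3 * b * ∑ H ∈ F, k * H.support.ncard := by
          rw [← Finset.mul_sum, ← Finset.mul_sum]
          ring
      _ ≤ _ := Nat.add_le_add_left (Nat.mul_le_mul_left _ hsum) _
  · intro K
    by_cases hK : ∃ x y, (G.deleteEdges D).Adj x y ∧ x ∈ K.supp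
    · obtain ⟨x₀, y₀, hxy₀, hx₀⟩ := hK
      obtain ⟨H, hH, hx₀H, -, -⟩ := hkeep _ _ hxy₀
      -- The trimmed vertex sets are disjoint, so a component cannot leave its piece, and the path
      -- of that piece covers it.
      have huniq : ∀ x, x ∈ H.support \ Y H → ∀ y, (G.deleteEdges D).Adj x y →
          y ∈ H.support \ Y H ∧ (x ∈ P H ∨ y ∈ P H) := by
        intro x hx y hxy
        obtain ⟨H', hH', hx', hy', hP'⟩ := hkeep _ _ hxy
        have heq : H = H' := by
          by_contra hne
          exact Set.disjoint_left.1 (hYdis H hH H' hH' hne) hx hx'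
        subst heq
        exact ⟨hy', hP'⟩
      have hwalk : ∀ x y, (G.deleteEdges D).Walk x y → x ∈ H.support \ Y H →
          y ∈ H.support \ Y H := by
        intro x y p
        induction p with
        | nil => exact id
        | cons h _ ih => exact fun hx => ih (huniq _ hx _ h).1
      refine ⟨P H, (hcov H hH).1, fun x y hxy hx => ?_⟩
      obtain ⟨p⟩ := ConnectedComponent.exact
        ((ConnectedComponent.mem_supp_iff _ _).1 hx₀ |>.trans
          ((ConnectedComponent.mem_supp_iff _ _).1 hx).symm)
      exact (huniq x (hwalk _ _ p hx₀H) y hxy).2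
    · push Not at hK
      exact ⟨∅, by simp, fun x y hxy hx => absurd hx (hK x y hxy)⟩

/-! ### Choice of constants -/

/-- For large `d` there are scales with `k ≈ d / N₁` and `b ≈ k / N₂`. -/
theorem exists_scales (N₁ N₂ : ℕ) (hN₁ : 1 ≤ N₁) (hN₂ : 4 ≤ N₂) :
    ∃ d₀ : ℕ, ∀ d, d₀ ≤ d → ∃ (g q T : ℕ) (s : ℕ → ℕ),
      Scales d (d / N₁) (d / N₁ / N₂) g q T s := by
  set T := 8 * N₁ with hT
  set M : ℕ → ℕ := fun m => N₁ * N₂ * (T + 2) ^ m with hM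
  have hMpos : ∀ m, 0 < M m := fun m => by positivity
  have hMmono : Monotone M := monotone_nat_of_le_succ fun m => by
    simp only [hM, pow_succ, ← mul_assoc]
    exact Nat.le_mul_of_pos_right _ (by omega)
  -- This makes d/g half of the smallest relevant scale d / M T, so the blocks are fewer than every
  -- `s m` with m ≤ T. It is constant in d, hence below b for large d.
  set g := 2 * M T with hg
  refine ⟨4 * M T + N₁ * N₂ * (g + 1), fun d hd => ⟨g, d / N₁ / 4, T, fun m => d / M m, ?_⟩⟩
  have hMT := hMpos T
  have hb : g + 1 ≤ d / N₁ / N₂ := by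
    rw [Nat.div_div_eq_div_mul, Nat.le_div_iff_mul_le (by positivity)]
    rw [mul_comm]
    omega
  have hbk : N₂ * (d / N₁ / N₂) ≤ d / N₁ := Nat.mul_div_le _ _
  have hbk' : 4 * (d / N₁ / N₂) ≤ d / N₁ := (Nat.mul_le_mul_right _ hN₂).trans hbk
  refine ⟨?_, fun m => ?_, fun m hm => ?_, by omega, by omega, hbk', by omega, ?_⟩
  · simp only [hM, pow_zero, mul_one, Nat.div_div_eq_div_mul]
  · have h1 : M (m + 1) = M m * (T + 2) := by simp only [hM, pow_succ]; ring
    rw [h1, ← Nat.div_div_eq_div_mul]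
    exact Nat.mul_div_le _ _
  · have h1 : d / M T ≤ d / M m := Nat.div_le_div_left (hMmono hm) (hMpos m)
    have h2 : d / g = d / M T / 2 := by rw [hg, mul_comm, Nat.div_div_eq_div_mul]
    have h3 : 4 ≤ d / M T := by
      rw [Nat.le_div_iff_mul_le hMT]
      omega
    change d / g + 1 < d / M m
    omega
  · have h1 : d < N₁ * (d / N₁ + 1) := Nat.lt_mul_div_succ d (by omega)
    -- Rounding is harmless as k ≥ 4; with q = k/4 rounded down, T = 8N₁ steps exceed d.
    have h2 : d / N₁ + 1 ≤ 8 * (d / N₁ / 4) := by omega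
    calc d < N₁ * (d / N₁ + 1) := h1
      _ ≤ N₁ * (8 * (d / N₁ / 4)) := Nat.mul_le_mul_left _ h2
      _ = T * (d / N₁ / 4) := by rw [hT]; ring

end SimpleGraph

theorem mainTheorem2 (ε : ℝ) (hε : 0 < ε) :
    ∃ C₀ : ℝ, ∀ C : ℝ, C₀ ≤ C → ∀ d : ℕ, C ≤ (d : ℝ) →
      ∀ (V : Type*) [Fintype V] [DecidableEq V] (G : SimpleGraph V) [DecidableRel G.Adj],
        (SimpleGraph.pathGraph (d + 1)).Free G →
        ε * (d : ℝ) * (Fintype.card V : ℝ) ≤ (G.edgeFinset.card : ℝ) →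
        ∃ D : Finset (Sym2 V), D ⊆ G.edgeFinset ∧
          (D.card : ℝ) ≤ ε * (G.edgeFinset.card : ℝ) ∧
          ∀ K : (G.deleteEdges (D : Set (Sym2 V))).ConnectedComponent,
            ∃ S : Finset K, K.toSimpleGraph.IsVertexCover (S : Set K) ∧
              (S.card : ℝ) ≤ C * (d : ℝ) := by
  -- These give 4k ≤ ε²d and 6b ≤ εk, so that the leftover edges and the edges deleted from pieces
  -- each amount to at most (ε/2)e(G).
  obtain ⟨N₁, hN₁⟩ := exists_nat_ge (4 / ε ^ 2)
  obtain ⟨N₂, hN₂⟩ := exists_nat_ge (6 / ε)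
  obtain ⟨d₀, hd₀⟩ := SimpleGraph.exists_scales (N₁ + 1) (N₂ + 4) (by omega) (by omega)
  -- C ≥ d₀ only serves to force d ≥ d₀; the covers have order at most d ≤ Cd.
  refine ⟨max d₀ 1, fun C hC d hCd V _ _ G _ hfree hdense => ?_⟩
  have hd : d₀ ≤ d := by exact_mod_cast (le_max_left _ _).trans (hC.trans hCd)
  have hC1 : 1 ≤ C := (le_max_right _ _).trans hC
  obtain ⟨g, q, T, s, hs⟩ := hd₀ d hd
  set k := d / (N₁ + 1) with hk
  set b := k / (N₂ + 4) with hb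
  have hP : SimpleGraph.PathsLT d G := by
    intro u v p hp
    by_contra hle
    push Not at hle
    have hc := (hp.take d).isContained_pathGraph
    rw [SimpleGraph.Walk.take_length, min_eq_left hle] at hc
    exact hfree hc
  obtain ⟨D, hDG, hDcard, hD⟩ := SimpleGraph.exists_deletion_cover hs hP
  have hDfin : ((Set.toFinite D).toFinset : Set (Sym2 V)) = D := Set.Finite.coe_toFinset _
  refine ⟨(Set.toFinite D).toFinset, ?_, ?_, ?_⟩
  · intro e he
    rw [SimpleGraph.mem_edgeFinset]
    exact hDG (by simpa using he)
  · rw [← Set.ncard_eq_toFinset_card]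
    have he : G.edgeSet.ncard = G.edgeFinset.card := by
      rw [← Set.ncard_coe_finset, SimpleGraph.coe_edgeFinset]
    rw [he, Nat.card_eq_fintype_card] at hDcard
    set e : ℝ := (G.edgeFinset.card : ℝ)
    set n : ℝ := (Fintype.card V : ℝ)
    have hkpos : (0 : ℝ) < k := by
      have h1 := hs.g_lt
      have h2 := hs.b_le
      exact_mod_cast (by omega : 0 < k)
    have he0 : 0 ≤ e := Nat.cast_nonneg _
    have hn0 : 0 ≤ n := Nat.cast_nonneg _
    have hkd : (k : ℝ) * (N₁ + 1) ≤ d := by exact_mod_cast Nat.div_mul_le_self d (N₁ + 1)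
    have hbk : (b : ℝ) * (N₂ + 4) ≤ k := by exact_mod_cast Nat.div_mul_le_self k (N₂ + 4)
    have hN₁' : 4 ≤ ε ^ 2 * N₁ := by
      rwa [div_le_iff₀ (by positivity), mul_comm] at hN₁
    have hN₂' : 6 ≤ ε * N₂ := by
      rwa [div_le_iff₀ hε, mul_comm] at hN₂
    have h4k : 4 * (k : ℝ) ≤ ε ^ 2 * d := by
      calc 4 * (k : ℝ) ≤ (ε ^ 2 * N₁) * k := by gcongr
        _ ≤ ε ^ 2 * (k * (N₁ + 1)) := by nlinarith [mul_pos (pow_pos hε 2) hkpos]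
        _ ≤ ε ^ 2 * d := by gcongr
    have h6b : 6 * (b : ℝ) ≤ ε * k := by
      have hb0 : (0 : ℝ) ≤ b := Nat.cast_nonneg _
      calc 6 * (b : ℝ) ≤ (ε * N₂) * b := by gcongr
        _ ≤ ε * (b * (N₂ + 4)) := by nlinarith [mul_nonneg hε.le hb0]
        _ ≤ ε * k := by gcongr
    have hcard : (k : ℝ) * D.ncard ≤ 2 * k * k * n + 3 * b * e := by
      have h := (Nat.cast_le (α := ℝ)).2 hDcard
      push_cast at h
      exact h
    have h1 : 2 * k * n ≤ ε / 2 * e := by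
      have h3 := mul_le_mul_of_nonneg_right h4k hn0
      have h4 := mul_le_mul_of_nonneg_left hdense hε.le
      linarith
    have h2 : 3 * b * e ≤ ε / 2 * e * k := by
      have h3 := mul_le_mul_of_nonneg_right h6b he0
      linarith
    have h3 := mul_le_mul_of_nonneg_left h1 hkpos.le
    refine le_of_mul_le_mul_left ?_ hkpos
    linarith
  · rw [hDfin]
    intro K
    obtain ⟨S, hS, hcov⟩ := hD K
    let S' : Set K := {x | (x : V) ∈ S}
    refine ⟨(Set.toFinite S').toFinset, ?_, ?_⟩
    · rw [Set.Finite.coe_toFinset]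
      intro x y hxy
      exact hcov x y hxy x.2
    · rw [← Set.ncard_eq_toFinset_card]
      have h1 : S'.ncard ≤ S.ncard := Set.ncard_le_ncard_of_injOn Subtype.val (fun x hx => hx)
        Subtype.val_injective.injOn
      calc (S'.ncard : ℝ) ≤ d := by exact_mod_cast h1.trans hS
        _ ≤ C * d := le_mul_of_one_le_left (Nat.cast_nonneg _) hC1
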